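/- **Setting.** Let $\mathbb M$ be a connected $d$-dimensional Riemannian manifold with distance $\mathrm{dist}$, volume measure $\mu$ and open balls $B(x,r)$. Let $\Omega\subset\mathbb M$ be compact. Let $r_\Omega>0$ and $0<\Gamma_1\le\Gamma_2$ be such that for every $z\in\Omega$ the exponential map $\mathrm{Exp}_z$ is a smooth diffeomorphism of the ball of radius $r_\Omega$ about $0$ in $T_z\mathbb M$ onto $B(z,r_\Omega)$ with $\mathrm{dist}(z,\mathrm{Exp}_z(v))=\|v\|$ and $\Gamma_1\|v-w\|\le \mathrm{dist}(\mathrm{Exp}_z(v),\mathrm{Exp}_z(w))\le\Gamma_2\|v-w\|$ for $\|v\|,\|w\|<r_\Omega$. Assume $\Omega$ satisfies an interior cone condition of radius $r^\flat>0$ and aperture $\theta\in(0,\pi/2)$: for each $z\in\Omega$ there is a unit vector $v\in T_z\mathbb M$ such that $\mathrm{Exp}_z(w)$ is defined and lies in $\Omega$ for all $w\in T_z\mathbb M$ with $\|w\|\le r^\flat$ and $\langle v,w\rangle\ge\|w\|\cos\theta$. Let $r^\sharp>0$ and $r^*=\min(r_\Omega,r^\sharp,r^\flat)$. **Lemma.**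 There are constants $0<\alpha_\Omega\le\omega_\Omega$ with $$\alpha_\Omega r^d\le\mu(B(x,r)\cap\Omega)\le\omega_\Omega r^d\qquad(x\in\Omega,\ 0<r\le r^*)\tag{1}$$ such that the following holds for all $\Pi,\Xi,\mathcal W,c_0,c_1,\delta$ as below. * $\Pi\subset C^1(\mathbb M)$ is a finite dimensional space of functions with constants $\mathfrak D,\mathfrak M>0$ such that $$\|p\|_{C(B(x,2r))}\le2^{\mathfrak D}\|p\|_{C(B(x,r))},\qquad \|\nabla p\|_{C(B(x,r))}\le\tfrac{\mathfrak M}{r}\|p\|_{C(B(x,r))}$$ for all $p\in\Pi$, $0<r<r^\sharp$, $x\in\mathbb M$. Put $$\kappa=\mathfrak M\,2^{2\mathfrak D}\Big(\frac{2+\sin\theta}{\Gamma_1\sin\theta}\Big)^{\mathfrak D}\frac{1+\Gamma_1\sin\theta}{\Gamma_1\sin\theta},$$ and assume that $\mathfrak M$ is large enough that $\kappa\ge\frac{1+\Gamma_1\sin\theta}{\Gamma_1\sin\theta}$ (for instance $\mathfrak M\ge1$). * $\Xi\subset\Omega$ is a finite nonempty set with fill distance $h=\max_{x\in\Omega}\mathrm{dist}(x,\Xi)\le\frac{r^*}{3\kappa}$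 and separation $q=\min_{\xi\in\Xi}\mathrm{dist}(\xi,\Xi\setminus\{\xi\})$. * $c_0\in(0,1)$, $c_1\in(0,1]$, $\delta\ge\frac{3\kappa}{c_0}h$, and $\mathcal W$ is a weight function with $0\le\mathcal W\le1$ on $\Omega\times\Omega$ and, for $\zeta,z\in\Omega$, $$\mathrm{dist}(\zeta,z)\ge\delta\Rightarrow\mathcal W(\zeta,z)=0,\qquad \mathrm{dist}(\zeta,z)\le c_0\delta\Rightarrow\mathcal W(\zeta,z)\ge c_1.$$ Then for each $z\in\Omega$ there is a unique vector $b^\star(\cdot,z)\in\mathbb R^\Xi$ that vanishes at the $\xi$ with $\mathcal W(\xi,z)=0$ and minimizes $$\sum_{\xi\in\Xi,\ \mathcal W(\xi,z)>0}\frac{|c_\xi|^2}{\mathcal W(\xi,z)}\quad\text{over } c\in\mathbb R^\Xi\text{ subject to}\quad\sum_{\xi\in\Xi,\ \mathcal W(\xi,z)>0}c_\xi\,p(\xi)=p(z)\ \text{ for all }p\in\Pi$$ (the Backus–Gilbert/moving least squares shape functions), and 1. $p(z)=\sum_{\xi\in\Xi}b^\star(\xi,z)p(\xi)$ for all $p\in\Pi$;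 2. $\{\xi\in\Xi: b^\star(\xi,z)\neq0\}\subset B(z,\delta)\cap\Omega$; 3. $\displaystyle\sum_{\xi\in\Xi}|b^\star(\xi,z)|\le2\sqrt{\frac{\omega_\Omega}{c_1\alpha_\Omega}}\Big(\frac\delta q\Big)^{d/2}$. Moreover, if $\alpha,\beta$ are any constants with $\alpha>0$ that satisfy (1) in place of $\alpha_\Omega,\omega_\Omega$, and $\delta+\frac q2\le r^*$, then $\displaystyle\sum_{\xi\in\Xi}|b^\star(\xi,z)|\le2\sqrt{\frac{\beta}{c_1\alpha}}\Big(1+\frac{2\delta}q\Big)^{d/2}$. -/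

import Mathlib

open Set Filter Topology MeasureTheory Bundle Manifold
open scoped ENNReal NNReal ContDiff

noncomputable section

namespace MLS

section Geometry

variable {d : ℕ} {M : Type*} [MetricSpace M] [ChartedSpace (EuclideanSpace ℝ (Fin d)) M]
  [IsManifold (𝓡 d) ∞ M] [RiemannianBundle (fun x : M => TangentSpace (𝓡 d) x)]

/-- The metric tensor in the coordinates given by the preferred chart at `x`: the value at the
coordinate point `y` of the bilinear form `g` on the coordinate vectors `u`, `w`. -/
def chartMetric (x : M) (y u w : EuclideanSpace ℝ (Fin d)) : ℝ :=
  inner ℝ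
    (mfderiv (𝓡 d) (𝓡 d) (extChartAt (𝓡 d) x).symm y u :
      TangentSpace (𝓡 d) ((extChartAt (𝓡 d) x).symm y))
    (mfderiv (𝓡 d) (𝓡 d) (extChartAt (𝓡 d) x).symm y w :
      TangentSpace (𝓡 d) ((extChartAt (𝓡 d) x).symm y))

/-- The Riemannian volume density `√(det (g_{ij}))` in the preferred chart at `x`. -/
def chartDensity (x : M) (y : EuclideanSpace ℝ (Fin d)) : ℝ :=
  Real.sqrt (Matrix.det (Matrix.of fun i j : Fin d =>
    chartMetric x y (EuclideanSpace.single i (1 : ℝ)) (EuclideanSpace.single j (1 : ℝ))))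

/-- The measure `√(det (g_{ij})) dx₁ ⋯ dx_d` on the domain of the preferred chart at `x`,
extended by zero to `M`. -/
def chartVolume [MeasurableSpace M] (x : M) : Measure M :=
  ((volume.restrict (extChartAt (𝓡 d) x).target).withDensity
    (fun y => ENNReal.ofReal (chartDensity x y))).map (extChartAt (𝓡 d) x).symm

variable (d M) in
/-- The Riemannian volume measure. The chart measures agree on overlaps of chart domains, and the
volume measure, which restricts to each of them, is the least measure dominating all of them. -/
def riemannianVolume [MeasurableSpace M] : Measure M :=
  ⨆ x : M, chartVolume (d := d) x

/-- `γ` satisfies the geodesic equation at time `t`. In the chart at `γ t`, with coordinate curve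
`c`, the equation `∑ₗ g_{kl} (c''ˡ + ∑_{ij} Γˡ_{ij} c'ⁱ c'ʲ) = 0`, contracted with an arbitrary
coordinate vector `w`, reads
`g(c'', w) + (D g)[c'](c', w) - ½ (D g)[w](c', c') = 0`. -/
def GeodesicEquationAt (γ : ℝ → M) (t : ℝ) : Prop :=
  let c : ℝ → EuclideanSpace ℝ (Fin d) := fun s => extChartAt (𝓡 d) (γ t) (γ s)
  ∀ w : EuclideanSpace ℝ (Fin d),
    chartMetric (γ t) (c t) (deriv (deriv c) t) w
      + fderiv ℝ (fun y => chartMetric (γ t) y (deriv c t) w) (c t) (deriv c t)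
      - 1 / 2 * fderiv ℝ (fun y => chartMetric (γ t) y (deriv c t) (deriv c t)) (c t) w = 0

/-- `γ` is a geodesic on an open interval containing `[0, 1]`. -/
def IsGeodesic (γ : ℝ → M) : Prop :=
  ∃ ε > (0 : ℝ), ContMDiffOn 𝓘(ℝ, ℝ) (𝓡 d) 2 γ (Ioo (-ε) (1 + ε)) ∧
    ∀ t ∈ Ioo (-ε) (1 + ε), GeodesicEquationAt (d := d) γ t

/-- `y = γ(1)` for a geodesic `γ` with `γ(0) = z` and `γ'(0) = v`. -/
def IsExp (z : M) (v : TangentSpace (𝓡 d) z) (y : M) : Prop :=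
  ∃ γ : ℝ → M, IsGeodesic (d := d) γ ∧
    (⟨γ 0, mfderiv 𝓘(ℝ, ℝ) (𝓡 d) γ 0 (1 : ℝ)⟩ : TangentBundle (𝓡 d) M) = ⟨z, v⟩ ∧ γ 1 = y

/-- The domain of the exponential map at `z` (`M` need not be complete). -/
def expDomain (z : M) : Set (TangentSpace (𝓡 d) z) := {v | ∃ y, IsExp z v y}

open Classical in
/-- The Riemannian exponential map at `z` (with the value `z` outside of its domain). -/
def expMap (z : M) (v : TangentSpace (𝓡 d) z) : M :=
  if h : ∃ y, IsExp z v y then h.choose else z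

/-- `r` is a radius such that, for each `z ∈ Ω`, the exponential map at `z` is a smooth
diffeomorphism of the ball `B(0, r)` of the tangent space onto the geodesic ball `B(z, r)`, it
preserves radial distances, and it distorts distances in `B(0, r)` by factors between `Γ₁` and
`Γ₂`. -/
structure IsNormalRadius (Ω : Set M) (r Γ₁ Γ₂ : ℝ) : Prop where
  radius_pos : 0 < r
  lower_pos : 0 < Γ₁
  lower_le_upper : Γ₁ ≤ Γ₂
  subset_domain : ∀ z ∈ Ω, ∀ v : TangentSpace (𝓡 d) z, ‖v‖ < r → v ∈ expDomain z
  diffeo : ∀ z ∈ Ω, ∃ Φ : PartialDiffeomorph (𝓡 d) (𝓡 d) (EuclideanSpace ℝ (Fin d)) M ∞,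
    Φ.source = {v : TangentSpace (𝓡 d) z | ‖v‖ < r} ∧ Φ.target = Metric.ball z r ∧
      ∀ v : TangentSpace (𝓡 d) z, ‖v‖ < r → Φ v = expMap z v
  radial : ∀ z ∈ Ω, ∀ v : TangentSpace (𝓡 d) z, ‖v‖ < r → dist z (expMap z v) = ‖v‖
  lower : ∀ z ∈ Ω, ∀ v w : TangentSpace (𝓡 d) z, ‖v‖ < r → ‖w‖ < r →
    Γ₁ * ‖v - w‖ ≤ dist (expMap z v) (expMap z w)
  upper : ∀ z ∈ Ω, ∀ v w : TangentSpace (𝓡 d) z, ‖v‖ < r → ‖w‖ < r →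
    dist (expMap z v) (expMap z w) ≤ Γ₂ * ‖v - w‖

variable (d) in
/-- The interior cone condition of radius `r` and aperture `θ`: each `z ∈ Ω` has a unit direction
`v` such that the geodesic cone
`Exp_z {w | ‖w‖ ≤ r, ⟨v, w⟩ ≥ ‖w‖ cos θ}` is contained in `Ω`. -/
def InteriorCone (Ω : Set M) (r θ : ℝ) : Prop :=
  ∀ z ∈ Ω, ∃ v : TangentSpace (𝓡 d) z, ‖v‖ = 1 ∧
    ∀ w : TangentSpace (𝓡 d) z, ‖w‖ ≤ r → ‖w‖ * Real.cos θ ≤ inner ℝ v w →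
      w ∈ expDomain z ∧ expMap z w ∈ Ω

/-- The supremum norm of `p` over a set, as an extended nonnegative real. -/
def supNorm (p : M → ℝ) (s : Set M) : ℝ≥0∞ := ⨆ y ∈ s, ‖p y‖ₑ

variable (d) in
/-- The supremum of `‖∇p‖` over a set, as an extended nonnegative real; the norm of the
differential at `y` is the dual norm of the Riemannian norm on the tangent space. -/
def gradSupNorm (p : M → ℝ) (s : Set M) : ℝ≥0∞ :=
  ⨆ y ∈ s, ‖(mfderiv (𝓡 d) 𝓘(ℝ, ℝ) p y : TangentSpace (𝓡 d) y →L[ℝ] ℝ)‖ₑ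

variable (d) in
/-- `P` is a finite dimensional space of `C¹` functions with a doubling inequality (constant `D`)
and a Markov inequality (constant `K`), valid on all balls of radius less than `r₀`. -/
structure DoublingMarkov (P : Submodule ℝ (M → ℝ)) (D K r₀ : ℝ) : Prop where
  finiteDimensional : FiniteDimensional ℝ P
  contMDiff : ∀ p ∈ P, ContMDiff (𝓡 d) 𝓘(ℝ, ℝ) 1 p
  doubling_pos : 0 < D
  markov_pos : 0 < K
  doubling : ∀ p ∈ P, ∀ r : ℝ, 0 < r → r < r₀ → ∀ x : M,
    supNorm p (Metric.ball x (2 * r)) ≤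
      ENNReal.ofReal ((2 : ℝ) ^ D) * supNorm p (Metric.ball x r)
  markov : ∀ p ∈ P, ∀ r : ℝ, 0 < r → r < r₀ → ∀ x : M,
    gradSupNorm d p (Metric.ball x r) ≤ ENNReal.ofReal (K / r) * supNorm p (Metric.ball x r)

variable (d) in
/-- `α r^d ≤ μ(B(x, r) ∩ Ω) ≤ β r^d` for all `x ∈ Ω` and `0 < r ≤ R`. -/
def BallBound [MeasurableSpace M] (Ω : Set M) (R α β : ℝ) : Prop :=
  ∀ x ∈ Ω, ∀ r : ℝ, 0 < r → r ≤ R →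
    ENNReal.ofReal (α * r ^ d) ≤ riemannianVolume d M (Metric.ball x r ∩ Ω) ∧
    riemannianVolume d M (Metric.ball x r ∩ Ω) ≤ ENNReal.ofReal (β * r ^ d)

end Geometry

/-- The constant
`κ = K 2^(2D) ((2 + sin θ)/(Γ₁ sin θ))^D (1 + Γ₁ sin θ)/(Γ₁ sin θ)`. -/
def kappa (D K Γ₁ θ : ℝ) : ℝ :=
  K * (2 : ℝ) ^ (2 * D) * ((2 + Real.sin θ) / (Γ₁ * Real.sin θ)) ^ D *
    ((1 + Γ₁ * Real.sin θ) / (Γ₁ * Real.sin θ))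

section Points

variable {M : Type*} [MetricSpace M]

/-- The fill distance `h = sup_{x ∈ Ω} dist(x, Ξ)` (for nonempty `Ξ` and bounded `Ω`). -/
def fillDistance (Ξ : Finset M) (Ω : Set M) : ℝ :=
  sSup ((fun x => Metric.infDist x (Ξ : Set M)) '' Ω)

/-- The separation radius `q = min_{ξ ∈ Ξ} dist(ξ, Ξ \ {ξ})` (for `Ξ` with at least two points). -/
def separation (Ξ : Finset M) : ℝ := Set.infsep (Ξ : Set M)

open Classical in
/-- The Backus–Gilbert functional `∑ |c_ξ|² / W(ξ, z)`, the sum being over the `ξ ∈ Ξ` with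
`W(ξ, z) > 0`. -/
def bgCost (Ξ : Finset M) (W : M → M → ℝ) (z : M) (c : Ξ → ℝ) : ℝ :=
  ∑ ξ ∈ Finset.univ.filter (fun ξ : Ξ => 0 < W ξ z), 1 / W ξ z * |c ξ| ^ 2

open Classical in
/-- The constraint `∑ c_ξ p(ξ) = p(z)` for all `p ∈ P`, the sum being over the `ξ ∈ Ξ` with
`W(ξ, z) > 0`. -/
def BGFeasible (P : Submodule ℝ (M → ℝ)) (Ξ : Finset M) (W : M → M → ℝ) (z : M)
    (c : Ξ → ℝ) : Prop :=
  ∀ p ∈ P, ∑ ξ ∈ Finset.univ.filter (fun ξ : Ξ => 0 < W ξ z), c ξ * p ξ = p z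

/-- `b = b*(·, z)` is a vector of values at `z` of the Backus–Gilbert shape functions: it
minimizes the Backus–Gilbert functional under the constraint. The entries with `W(ξ, z) = 0`,
which occur neither in the functional nor in the constraint, are zero by convention. -/
structure IsShapeVector (P : Submodule ℝ (M → ℝ)) (Ξ : Finset M) (W : M → M → ℝ) (z : M)
    (b : Ξ → ℝ) : Prop where
  eq_zero : ∀ ξ : Ξ, W ξ z = 0 → b ξ = 0
  feasible : BGFeasible P Ξ W z b
  minimal : ∀ c : Ξ → ℝ, BGFeasible P Ξ W z c → bgCost Ξ W z b ≤ bgCost Ξ W z c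

end Points

end MLS

end

/-!
Charts that are bi-Lipschitz near a point compare Riemannian with Euclidean volumes, so by
compactness the Riemannian volume is Ahlfors regular at the points of `Ω` up to some scale. The
exponential map carries a ball inscribed in the cone at `z ∈ Ω` to a set containing a geodesic ball
of comparable size, which therefore lies in `Ω`. This gives the lower volume bound for
`B(x, r) ∩ Ω`. It also lets doubling propagate bounds on `p` from that ball to a ball about `z`,
where the Markov inequality turns them into a Lipschitz bound; hence `|p z|` is at most twice the
maximum of `|p|` over the nodes near `z`. By Hahn–Banach, evaluation at `z` is then a combination of
evaluations at these nodes with coefficients of `ℓ¹` norm at most `2`. The Backus–Gilbert cost of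
this combination, and therefore of the minimizer, is at most `4 / c₁`; Cauchy–Schwarz and the volume
count of the `q`-separated nodes in `B(z, δ)` turn this into the bound on the `ℓ¹` norm of the
minimizer.
-/

namespace MLS

section Duality

theorem exists_continuousLinearMap_comp_eq {V F : Type*} [AddCommGroup V] [Module ℝ V]
    [NormedAddCommGroup F] [NormedSpace ℝ F] (L : V →ₗ[ℝ] F) (f : V →ₗ[ℝ] ℝ) {C : ℝ}
    (hC : 0 ≤ C) (hf : ∀ v, |f v| ≤ C * ‖L v‖) :
    ∃ g : F →L[ℝ] ℝ, (∀ v, g (L v) = f v) ∧ ‖g‖ ≤ C := by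
  obtain ⟨s, hs⟩ := L.rangeRestrict.exists_rightInverse_of_surjective L.range_rangeRestrict
  have hLs : ∀ y, L (s y) = y := fun y => congrArg Subtype.val (LinearMap.congr_fun hs y)
  have hbound : ∀ y, ‖(f ∘ₗ s) y‖ ≤ C * ‖y‖ := fun y => by
    simpa [hLs] using hf (s y)
  obtain ⟨g, hg, hgnorm⟩ :=
    exists_extension_norm_eq (LinearMap.range L) ((f ∘ₗ s).mkContinuous C hbound)
  refine ⟨g, fun v => ?_, hgnorm.trans_le ((f ∘ₗ s).mkContinuous_norm_le hC hbound)⟩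
  have hfv : f (s (L.rangeRestrict v)) = f v := by
    have h := hf (s (L.rangeRestrict v) - v)
    rwa [map_sub, map_sub, hLs, LinearMap.codRestrict_apply, sub_self, norm_zero, mul_zero,
      abs_nonpos_iff, sub_eq_zero] at h
  exact (hg (L.rangeRestrict v)).trans hfv

theorem sum_abs_apply_single_le_norm {ι : Type*} [Fintype ι] [DecidableEq ι]
    (g : (ι → ℝ) →L[ℝ] ℝ) : ∑ i, |g (Pi.single i 1)| ≤ ‖g‖ := by
  let ε : ι → ℝ := fun i => SignType.sign (g (Pi.single i 1))
  have hε : ‖ε‖ ≤ 1 := (pi_norm_le_iff_of_nonneg zero_le_one).2 fun i => by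
    rcases lt_trichotomy (g (Pi.single i 1)) 0 with hs | hs | hs <;> simp [ε, hs]
  calc
    ∑ i, |g (Pi.single i 1)| = g ε := by
      rw [pi_eq_sum_univ' ε, map_sum]
      exact Finset.sum_congr rfl fun i _ => by rw [map_smul, smul_eq_mul, sign_mul_self]
    _ ≤ ‖g‖ * ‖ε‖ := (le_abs_self _).trans (g.le_opNorm ε)
    _ ≤ ‖g‖ := mul_le_of_le_one_right (norm_nonneg g) hε

theorem exists_eq_sum_smul_of_abs_le {V ι : Type*} [AddCommGroup V] [Module ℝ V] [Fintype ι]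
    (e : ι → V →ₗ[ℝ] ℝ) (f : V →ₗ[ℝ] ℝ) {C : ℝ} (hC : 0 ≤ C)
    (hf : ∀ v m, 0 ≤ m → (∀ i, |e i v| ≤ m) → |f v| ≤ C * m) :
    ∃ a : ι → ℝ, f = ∑ i, a i • e i ∧ ∑ i, |a i| ≤ C := by
  classical
  obtain ⟨g, hg, hgC⟩ := exists_continuousLinearMap_comp_eq (LinearMap.pi e) f hC fun v =>
    hf v _ (norm_nonneg _) fun i => norm_le_pi_norm (LinearMap.pi e v) i
  refine ⟨fun i => g (Pi.single i 1), LinearMap.ext fun v => ?_,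
    (sum_abs_apply_single_le_norm g).trans hgC⟩
  rw [← hg v, pi_eq_sum_univ' (LinearMap.pi e v), map_sum, LinearMap.sum_apply]
  exact Finset.sum_congr rfl fun i _ => by
    rw [map_smul, LinearMap.pi_apply, LinearMap.smul_apply, smul_eq_mul, smul_eq_mul, mul_comm]

end Duality

section Corkscrew

/-- The interior corkscrew property of `Ω` at scales below `R`: within distance `ρ` of each
`z ∈ Ω` there is a ball contained in `Ω`, centred at distance `ρ / (1 + σ)` from `z`, whose radius
is `a` times that distance and which does not contain `z`. In a Euclidean cone of aperture `θ` one
may take `σ = a = sin θ`; the exponential map may shrink the ball. -/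
structure InteriorCorkscrew {M : Type*} [PseudoMetricSpace M] (Ω : Set M) (R σ a : ℝ) : Prop where
  offset_pos : 0 < σ
  offset_le_one : σ ≤ 1
  ratio_pos : 0 < a
  exists_ball : ∀ z ∈ Ω, ∀ ρ, 0 < ρ → ρ < R → ∃ y ∈ Ω, dist z y = ρ / (1 + σ) ∧
    z ∉ Metric.ball y (a * (ρ / (1 + σ))) ∧
    Metric.ball y (a * (ρ / (1 + σ))) ⊆ Ω ∩ Metric.closedBall z ρ

theorem InteriorCorkscrew.ratio_le_one {M : Type*} [PseudoMetricSpace M] {Ω : Set M} {R σ a : ℝ}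
    (h : InteriorCorkscrew Ω R σ a) (hΩ : Ω.Nonempty) (hR : 0 < R) : a ≤ 1 := by
  obtain ⟨z, hz⟩ := hΩ
  obtain ⟨y, -, hdist, hmem, -⟩ := h.exists_ball z hz (R / 2) (half_pos hR) (half_lt_self hR)
  have hs : 0 < R / 2 / (1 + σ) := div_pos (half_pos hR) (by linarith [h.offset_pos])
  rw [Metric.mem_ball, not_lt, hdist] at hmem
  exact le_of_mul_le_mul_right (by rwa [one_mul]) hs

theorem InteriorCorkscrew.exists_dist_eq {M : Type*} [PseudoMetricSpace M] {Ω : Set M} {R σ a : ℝ}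
    (h : InteriorCorkscrew Ω R σ a) {z : M} (hz : z ∈ Ω) {t : ℝ} (ht : 0 < t) (htR : 2 * t < R) :
    ∃ y ∈ Ω, dist z y = t := by
  have hσ : 0 < 1 + σ := by linarith [h.offset_pos]
  obtain ⟨y, hy, hdist, -⟩ := h.exists_ball z hz (t * (1 + σ)) (mul_pos ht hσ)
    (by nlinarith [h.offset_le_one])
  exact ⟨y, hy, by rw [hdist, mul_div_cancel_right₀ _ hσ.ne']⟩

theorem norm_mul_cos_le_inner_of_norm_sub_lt {E : Type*} [NormedAddCommGroup E]
    [InnerProductSpace ℝ E] {v w : E} {s θ : ℝ} (hv : ‖v‖ = 1) (hs : 0 ≤ s)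
    (hw : ‖w - s • v‖ < s * Real.sin θ) :
    ‖w‖ * Real.cos θ ≤ inner ℝ v w := by
  obtain ⟨e, rfl⟩ : ∃ e, w = s • v + e := ⟨w - s • v, by abel⟩
  rw [add_sub_cancel_left] at hw
  have hcos : Real.cos θ ^ 2 = 1 - Real.sin θ ^ 2 := by linarith [Real.sin_sq_add_cos_sq θ]
  have hinner : inner ℝ v (s • v + e) = s + inner ℝ v e := by
    rw [inner_add_right, real_inner_smul_right, real_inner_self_eq_norm_sq, hv]; ring
  have hnorm : ‖s • v + e‖ ^ 2 = s ^ 2 + 2 * s * inner ℝ v e + ‖e‖ ^ 2 := by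
    rw [norm_add_sq_real, norm_smul, hv, real_inner_smul_left, Real.norm_eq_abs, mul_one, sq_abs]
    ring
  have hve : |inner ℝ v e| ≤ ‖e‖ := by
    simpa [hv] using abs_real_inner_le_norm v e
  have hsin : s * Real.sin θ ≤ s := mul_le_of_le_one_right hs (Real.sin_le_one θ)
  have he : ‖e‖ ^ 2 ≤ (s * Real.sin θ) ^ 2 := by gcongr
  rw [hinner]
  refine (abs_le_of_sq_le_sq' ?_ (by linarith [(abs_le.1 hve).1])).2
  rw [mul_pow, hnorm, hcos]
  nlinarith [mul_le_mul_of_nonneg_left he (sub_nonneg.2 (Real.sin_sq_le_one θ)),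
    sq_nonneg (inner ℝ v e + Real.sin θ ^ 2 * s)]

variable {d : ℕ} {M : Type*} [MetricSpace M] [ChartedSpace (EuclideanSpace ℝ (Fin d)) M]
  [RiemannianBundle (fun x : M => TangentSpace (𝓡 d) x)] {Ω : Set M} {rΩ Γ₁ Γ₂ : ℝ}

theorem IsNormalRadius.expMap_zero (h : IsNormalRadius (d := d) Ω rΩ Γ₁ Γ₂) {z : M} (hz : z ∈ Ω) :
    expMap z (0 : TangentSpace (𝓡 d) z) = z := by
  have hdist := h.radial z hz 0 (by simpa only [norm_zero] using h.radius_pos)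
  exact (dist_eq_zero.1 (hdist.trans norm_zero)).symm

theorem IsNormalRadius.lower_le_one (h : IsNormalRadius (d := d) Ω rΩ Γ₁ Γ₂) {z : M} (hz : z ∈ Ω)
    {v : TangentSpace (𝓡 d) z} (hv : 0 < ‖v‖) (hvr : ‖v‖ < rΩ) : Γ₁ ≤ 1 := by
  have hlow := h.lower z hz v 0 hvr (by simpa only [norm_zero] using h.radius_pos)
  rw [h.expMap_zero hz, dist_comm, h.radial z hz v hvr, sub_zero] at hlow
  exact le_of_mul_le_mul_right (by rwa [one_mul]) hv

theorem IsNormalRadius.exists_expMap_eq (h : IsNormalRadius (d := d) Ω rΩ Γ₁ Γ₂) {z x : M}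
    (hz : z ∈ Ω) (hx : x ∈ Metric.ball z rΩ) :
    ∃ w : TangentSpace (𝓡 d) z, ‖w‖ < rΩ ∧ expMap z w = x := by
  obtain ⟨Φ, hsource, htarget, hΦ⟩ := h.diffeo z hz
  rw [← htarget] at hx
  have hw : Φ.toPartialEquiv.symm x ∈ {v : TangentSpace (𝓡 d) z | ‖v‖ < rΩ} :=
    hsource ▸ Φ.toPartialEquiv.map_target hx
  exact ⟨Φ.toPartialEquiv.symm x, hw, (hΦ _ hw).symm.trans (Φ.toPartialEquiv.right_inv hx)⟩

theorem IsNormalRadius.interiorCorkscrew (h : IsNormalRadius (d := d) Ω rΩ Γ₁ Γ₂) {rflat θ R : ℝ}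
    (hcone : InteriorCone d Ω rflat θ) (hθ : 0 < Real.sin θ) (hRΩ : R ≤ rΩ) (hRflat : R ≤ rflat) :
    InteriorCorkscrew Ω R (Real.sin θ) (Γ₁ * Real.sin θ) where
  offset_pos := hθ
  offset_le_one := Real.sin_le_one θ
  ratio_pos := mul_pos h.lower_pos hθ
  exists_ball z hz ρ hρ hρR := by
    obtain ⟨v, hv, hvcone⟩ := hcone z hz
    set s := ρ / (1 + Real.sin θ) with hs
    have hs0 : 0 < s := by positivity
    have hsρ : s + s * Real.sin θ = ρ := by rw [hs]; field_simp
    have hsθ : 0 < s * Real.sin θ := by positivity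
    have hnorm : ‖s • v‖ = s := by rw [norm_smul, hv, mul_one, Real.norm_of_nonneg hs0.le]
    have hsr : ‖s • v‖ < rΩ := by linarith
    have hdist : dist z (expMap z (s • v)) = s := (h.radial z hz _ hsr).trans hnorm
    have hΓ := h.lower_le_one hz (hs0.trans_eq hnorm.symm) hsr
    have hmem : ∀ w : TangentSpace (𝓡 d) z, ‖w - s • v‖ < s * Real.sin θ →
        ‖w‖ ≤ ρ ∧ expMap z w ∈ Ω := fun w hw => by
      have hwρ : ‖w‖ ≤ ρ := by linarith [norm_le_norm_sub_add w (s • v)]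
      exact ⟨hwρ, (hvcone w (by linarith)
        (norm_mul_cos_le_inner_of_norm_sub_lt hv hs0.le hw)).2⟩
    refine ⟨expMap z (s • v), (hmem _ (by simpa only [sub_self, norm_zero])).2, hdist, ?_, ?_⟩
    · rw [Metric.mem_ball, hdist, not_lt]
      exact mul_le_of_le_one_left hs0.le (mul_le_one₀ hΓ hθ.le (Real.sin_le_one θ))
    · intro x hx
      rw [Metric.mem_ball] at hx
      have hxz : x ∈ Metric.ball z rΩ := by
        rw [Metric.mem_ball]
        nlinarith [dist_triangle_right x z (expMap z (s • v))]
      obtain ⟨w, hw, rfl⟩ := h.exists_expMap_eq hz hxz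
      have hws : ‖w - s • v‖ < s * Real.sin θ :=
        lt_of_mul_lt_mul_left (by linarith [h.lower z hz w (s • v) hw hsr]) h.lower_pos.le
      refine ⟨(hmem w hws).2, ?_⟩
      rw [Metric.mem_closedBall, dist_comm, h.radial z hz w hw]
      exact (hmem w hws).1

end Corkscrew

section Lipschitz

variable {E E' H H' : Type*} [NormedAddCommGroup E] [NormedSpace ℝ E] [NormedAddCommGroup E']
  [NormedSpace ℝ E'] [TopologicalSpace H] [TopologicalSpace H'] {I : ModelWithCorners ℝ E H}
  {I' : ModelWithCorners ℝ E' H'}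

theorem pathELength_comp_le {M N : Type*} [TopologicalSpace M] [ChartedSpace H M]
    [TopologicalSpace N] [ChartedSpace H' N] [∀ x : M, ENorm (TangentSpace I x)]
    [∀ x : N, ENorm (TangentSpace I' x)] {f : M → N} {γ : ℝ → M} {a b : ℝ} (hab : a < b) {G : ℝ≥0}
    (hf : ∀ t ∈ Icc a b, MDifferentiableAt I I' f (γ t))
    (hγ : MDifferentiableOn 𝓘(ℝ, ℝ) I γ (Icc a b))
    (hG : ∀ t ∈ Icc a b, ∀ v : TangentSpace I (γ t), ‖mfderiv I I' f (γ t) v‖ₑ ≤ G * ‖v‖ₑ) :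
    pathELength I' (f ∘ γ) a b ≤ G * pathELength I γ a b := by
  rw [pathELength_eq_lintegral_mfderivWithin_Icc, pathELength_eq_lintegral_mfderivWithin_Icc,
    ← lintegral_const_mul' _ _ ENNReal.coe_ne_top]
  refine setLIntegral_mono' measurableSet_Icc fun t ht => ?_
  rw [mfderiv_comp_mfderivWithin t (hf t ht) (hγ t ht)
    (uniqueMDiffWithinAt_iff_uniqueDiffWithinAt.2 (uniqueDiffOn_Icc hab t ht))]
  exact hG t ht _

variable {M N : Type*} [PseudoMetricSpace M] [ChartedSpace H M]
  [RiemannianBundle (fun x : M => TangentSpace I x)] [IsRiemannianManifold I M]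

variable (I) in
theorem exists_path_of_dist_lt {x y : M} {L : ℝ} (hL : dist x y < L) :
    ∃ γ : ℝ → M, γ 0 = x ∧ γ 1 = y ∧ ContMDiffOn 𝓘(ℝ, ℝ) I 1 γ (Icc 0 1) ∧
      pathELength I γ 0 1 < ENNReal.ofReal L ∧ ∀ t ∈ Icc (0 : ℝ) 1, dist x (γ t) < L := by
  have hL0 : 0 < L := dist_nonneg.trans_lt hL
  obtain ⟨γ, h0, h1, hγ, hlen⟩ : ∃ γ : ℝ → M, γ 0 = x ∧ γ 1 = y ∧
      ContMDiffOn 𝓘(ℝ, ℝ) I 1 γ (Icc 0 1) ∧ pathELength I γ 0 1 < ENNReal.ofReal L :=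
    exists_lt_of_riemannianEDist_lt <| by
      rwa [← IsRiemannianManifold.out, edist_dist, ENNReal.ofReal_lt_ofReal_iff hL0]
  refine ⟨γ, h0, h1, hγ, hlen, fun t ht => ?_⟩
  rw [← ENNReal.ofReal_lt_ofReal_iff hL0, ← edist_dist, IsRiemannianManifold.out (I := I)]
  calc
    riemannianEDist I x (γ t) ≤ pathELength I γ 0 t :=
      riemannianEDist_le_pathELength (hγ.mono (Icc_subset_Icc_right ht.2)) h0 rfl ht.1
    _ ≤ pathELength I γ 0 1 := pathELength_mono le_rfl ht.2
    _ < ENNReal.ofReal L := hlen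

variable [PseudoMetricSpace N] [ChartedSpace H' N]
  [RiemannianBundle (fun x : N => TangentSpace I' x)] [IsRiemannianManifold I' N]

theorem dist_le_mul_of_mfderiv_le {f : M → N} {z x y : M} {R : ℝ} {G : ℝ≥0}
    (hf : ContMDiffOn I I' 1 f (Metric.ball z R))
    (hG : ∀ u ∈ Metric.ball z R, ∀ v : TangentSpace I u, ‖mfderiv I I' f u v‖ₑ ≤ G * ‖v‖ₑ)
    (hxy : dist x z + dist x y < R) : dist (f x) (f y) ≤ G * dist x y := by
  suffices ∀ L, dist x y < L → L < R - dist x z → dist (f x) (f y) ≤ G * L from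
    ge_of_tendsto ((continuous_const_mul (G : ℝ)).tendsto (dist x y) |>.mono_left
      nhdsWithin_le_nhds) (by
        filter_upwards [Ioo_mem_nhdsGT (lt_sub_iff_add_lt'.2 hxy)] with L hL
        exact this L hL.1 hL.2)
  intro L hL hLR
  obtain ⟨γ, rfl, rfl, hγ, hlen, hdist⟩ := exists_path_of_dist_lt I hL
  have hmem : MapsTo γ (Icc 0 1) (Metric.ball z R) := fun t ht => by
    rw [Metric.mem_ball]
    linarith [hdist t ht, dist_triangle_left (γ t) z (γ 0)]
  have hmdiff : ∀ t ∈ Icc (0 : ℝ) 1, MDifferentiableAt I I' f (γ t) := fun t ht =>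
    (hf.contMDiffAt (Metric.isOpen_ball.mem_nhds (hmem ht))).mdifferentiableAt one_ne_zero
  rw [← ENNReal.ofReal_le_ofReal_iff (mul_nonneg G.coe_nonneg (dist_nonneg.trans hL.le)),
    ← edist_dist]
  calc
    edist (f (γ 0)) (f (γ 1)) = riemannianEDist I' (f (γ 0)) (f (γ 1)) :=
      IsRiemannianManifold.out _ _
    _ ≤ pathELength I' (f ∘ γ) 0 1 :=
      riemannianEDist_le_pathELength (hf.comp hγ hmem) rfl rfl zero_le_one
    _ ≤ G * pathELength I γ 0 1 :=
      pathELength_comp_le zero_lt_one hmdiff (hγ.mdifferentiableOn one_ne_zero)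
        fun t ht => hG _ (hmem ht)
    _ ≤ G * ENNReal.ofReal L := by gcongr
    _ = ENNReal.ofReal (G * L) := by rw [ENNReal.ofReal_mul G.coe_nonneg, ENNReal.ofReal_coe_nnreal]

theorem lipschitzOnWith_of_mfderiv_le {f : M → N} {z : M} {R : ℝ} {G : ℝ≥0}
    (hf : ContMDiffOn I I' 1 f (Metric.ball z R))
    (hG : ∀ u ∈ Metric.ball z R, ∀ v : TangentSpace I u, ‖mfderiv I I' f u v‖ₑ ≤ G * ‖v‖ₑ) :
    LipschitzOnWith G f (Metric.ball z (R / 3)) :=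
  LipschitzOnWith.of_dist_le_mul fun x hx y hy => dist_le_mul_of_mfderiv_le hf hG <| by
    rw [Metric.mem_ball] at hx hy
    linarith [dist_triangle_right x y z]

end Lipschitz

section Density

theorem normDet_le_pow_of_lipschitzWith {U V : Type*} [NormedAddCommGroup U]
    [InnerProductSpace ℝ U] [FiniteDimensional ℝ U] [NormedAddCommGroup V] [InnerProductSpace ℝ V]
    {f : U →ₗ[ℝ] V} {K : ℝ≥0} (hf : LipschitzWith K f) :
    f.normDet ≤ K ^ Module.finrank ℝ U := by
  borelize U V
  have h := hf.hausdorffMeasure_image_le (Module.finrank ℝ U).cast_nonneg (Metric.ball 0 1)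
  rw [f.hausdorffMeasure_image, ENNReal.mul_le_mul_iff_left
    (Metric.measure_ball_pos _ _ one_pos).ne' measure_ball_lt_top.ne, ENNReal.rpow_natCast,
    ← ENNReal.coe_pow] at h
  exact ENNReal.ofReal_le_coe.1 h

theorem inv_pow_le_normDet_of_antilipschitzWith {U V : Type*} [NormedAddCommGroup U]
    [InnerProductSpace ℝ U] [FiniteDimensional ℝ U] [NormedAddCommGroup V] [InnerProductSpace ℝ V]
    {f : U →ₗ[ℝ] V} {K : ℝ≥0} (hK : 0 < K) (hf : AntilipschitzWith K f) :
    (K : ℝ)⁻¹ ^ Module.finrank ℝ U ≤ f.normDet := by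
  borelize U V
  have h := hf.le_hausdorffMeasure_image (Module.finrank ℝ U).cast_nonneg (Metric.ball 0 1)
  rw [f.hausdorffMeasure_image, ← mul_assoc] at h
  nth_rewrite 1 [← one_mul (μH[_] _)] at h
  rw [ENNReal.mul_le_mul_iff_left
    (Metric.measure_ball_pos _ _ one_pos).ne' measure_ball_lt_top.ne, ENNReal.rpow_natCast,
    ← ENNReal.ofReal_coe_nnreal, ← ENNReal.ofReal_pow K.coe_nonneg,
    ← ENNReal.ofReal_mul (by positivity), ENNReal.one_le_ofReal] at h
  rwa [inv_pow, inv_le_iff_one_le_mul₀' (by positivity)]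

variable {d : ℕ} {M : Type*} [MetricSpace M] [ChartedSpace (EuclideanSpace ℝ (Fin d)) M]

theorem mdifferentiableAt_extChartAt_symm [IsManifold (𝓡 d) 1 M] {x : M}
    {y : EuclideanSpace ℝ (Fin d)} (hy : y ∈ (extChartAt (𝓡 d) x).target) :
    MDifferentiableAt (𝓡 d) (𝓡 d) (extChartAt (𝓡 d) x).symm y :=
  ((contMDiffOn_extChartAt_symm x).contMDiffAt
    ((isOpen_extChartAt_target x).mem_nhds hy)).mdifferentiableAt one_ne_zero

/-- The transition map from the preferred chart at `x` to the preferred chart at `x'`. -/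
noncomputable def chartTransition (x x' : M) :
    EuclideanSpace ℝ (Fin d) → EuclideanSpace ℝ (Fin d) :=
  extChartAt (𝓡 d) x' ∘ (extChartAt (𝓡 d) x).symm

/-- The domain of `chartTransition x x'`. -/
def chartOverlap (x x' : M) : Set (EuclideanSpace ℝ (Fin d)) :=
  (extChartAt (𝓡 d) x).target ∩ (extChartAt (𝓡 d) x).symm ⁻¹' (extChartAt (𝓡 d) x').source

theorem isOpen_chartOverlap (x x' : M) : IsOpen (chartOverlap (d := d) x x') :=
  (continuousOn_extChartAt_symm x).isOpen_inter_preimage (isOpen_extChartAt_target x)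
    (isOpen_extChartAt_source x')

theorem differentiableAt_chartTransition [IsManifold (𝓡 d) 1 M] {x x' : M}
    {y : EuclideanSpace ℝ (Fin d)} (hy : y ∈ chartOverlap x x') :
    DifferentiableAt ℝ (chartTransition x x') y :=
  ((contDiffOn_ext_coord_change (I := 𝓡 d) (n := 1) x' x).contDiffAt
    ((isOpen_chartOverlap x x').mem_nhds hy)).differentiableAt one_ne_zero

theorem mfderiv_extChartAt_symm_eq_comp [IsManifold (𝓡 d) 1 M] {x x' : M}
    {y : EuclideanSpace ℝ (Fin d)} (hy : y ∈ chartOverlap x x') :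
    mfderiv (𝓡 d) (𝓡 d) (extChartAt (𝓡 d) x).symm y =
      (mfderiv (𝓡 d) (𝓡 d) (extChartAt (𝓡 d) x').symm (chartTransition x x' y)).comp
        (fderiv ℝ (chartTransition x x') y) := by
  have heq : (extChartAt (𝓡 d) x).symm =ᶠ[𝓝 y]
      (extChartAt (𝓡 d) x').symm ∘ chartTransition x x' := by
    filter_upwards [(isOpen_chartOverlap x x').mem_nhds hy] with w hw
    exact ((extChartAt (𝓡 d) x').left_inv hw.2).symm
  have hcomp := mfderiv_comp (I := 𝓡 d) (I' := 𝓡 d) (I'' := 𝓡 d) y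
    (g := (extChartAt (𝓡 d) x').symm) (f := chartTransition x x')
    (mdifferentiableAt_extChartAt_symm ((extChartAt (𝓡 d) x').map_source hy.2))
    (differentiableAt_chartTransition hy).mdifferentiableAt
  rw [mfderiv_eq_fderiv] at hcomp
  exact heq.mfderiv_eq.trans hcomp

variable [RiemannianBundle (fun x : M => TangentSpace (𝓡 d) x)]

theorem chartDensity_eq_normDet {x p : M} {y : EuclideanSpace ℝ (Fin d)}
    (hp : (extChartAt (𝓡 d) x).symm y = p) :
    chartDensity x y =
      LinearMap.normDet (U := EuclideanSpace ℝ (Fin d)) (V := TangentSpace (𝓡 d) p)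
        (mfderiv (𝓡 d) (𝓡 d) (extChartAt (𝓡 d) x).symm y).toLinearMap := by
  subst hp
  have h := LinearMap.normDet_sq_eq_det_gram (U := EuclideanSpace ℝ (Fin d))
    (V := TangentSpace (𝓡 d) ((extChartAt (𝓡 d) x).symm y))
    (mfderiv (𝓡 d) (𝓡 d) (extChartAt (𝓡 d) x).symm y).toLinearMap
    (EuclideanSpace.basisFun (Fin d) ℝ)
  simp only [EuclideanSpace.basisFun_apply] at h
  exact (congrArg Real.sqrt h.symm).trans (Real.sqrt_sq (LinearMap.normDet_nonneg _))

theorem chartDensity_transition [IsManifold (𝓡 d) 1 M] {x x' : M}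
    {y : EuclideanSpace ℝ (Fin d)} (hy : y ∈ chartOverlap x x') :
    chartDensity x y =
      |(fderiv ℝ (chartTransition x x') y).det| * chartDensity x' (chartTransition x x' y) := by
  have hp : (extChartAt (𝓡 d) x').symm (chartTransition x x' y) = (extChartAt (𝓡 d) x).symm y :=
    (extChartAt (𝓡 d) x').left_inv hy.2
  have hcomp := LinearMap.normDet_comp_of_finrank_eq (U := EuclideanSpace ℝ (Fin d))
    (V := EuclideanSpace ℝ (Fin d)) (W := TangentSpace (𝓡 d) ((extChartAt (𝓡 d) x).symm y))
    (fderiv ℝ (chartTransition x x') y).toLinearMap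
    (mfderiv (𝓡 d) (𝓡 d) (extChartAt (𝓡 d) x').symm (chartTransition x x' y)).toLinearMap rfl
  rw [LinearMap.normDet_eq_abs_det, ← chartDensity_eq_normDet hp,
    mul_comm (chartDensity _ _)] at hcomp
  refine (chartDensity_eq_normDet rfl).trans (Eq.trans ?_ hcomp)
  exact congrArg (fun L : EuclideanSpace ℝ (Fin d) →L[ℝ] EuclideanSpace ℝ (Fin d) =>
    LinearMap.normDet (U := EuclideanSpace ℝ (Fin d))
      (V := TangentSpace (𝓡 d) ((extChartAt (𝓡 d) x).symm y)) L.toLinearMap)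
    (mfderiv_extChartAt_symm_eq_comp hy)

end Density

section ChartControl

variable {d : ℕ} {M : Type*} [MetricSpace M] [ChartedSpace (EuclideanSpace ℝ (Fin d)) M]
  [RiemannianBundle (fun x : M => TangentSpace (𝓡 d) x)]

theorem chartDensity_le_pow {x : M} {y : EuclideanSpace ℝ (Fin d)} {C : ℝ≥0}
    (h : ∀ u : TangentSpace (𝓡 d) y,
      ‖mfderiv (𝓡 d) (𝓡 d) (extChartAt (𝓡 d) x).symm y u‖ₑ ≤ C * ‖u‖ₑ) :
    chartDensity x y ≤ C ^ d := by
  rw [chartDensity_eq_normDet rfl]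
  refine (normDet_le_pow_of_lipschitzWith (K := C) ?_).trans_eq (by rw [finrank_euclideanSpace_fin])
  refine AddMonoidHomClass.lipschitz_of_bound_nnnorm _ _ fun u => ?_
  exact ENNReal.coe_le_coe.1
    ((h u).trans_eq (congrArg ((C : ℝ≥0∞) * ·) enorm_tangentSpace_vectorSpace))

theorem inv_pow_le_chartDensity [IsManifold (𝓡 d) 1 M] {x : M} {y : EuclideanSpace ℝ (Fin d)}
    (hy : y ∈ (extChartAt (𝓡 d) x).target) {C : ℝ≥0} (hC : 0 < C)
    (h : ∀ v : TangentSpace (𝓡 d) ((extChartAt (𝓡 d) x).symm y),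
      ‖mfderiv (𝓡 d) (𝓡 d) (extChartAt (𝓡 d) x) _ v‖ₑ ≤ C * ‖v‖ₑ) :
    (C : ℝ)⁻¹ ^ d ≤ chartDensity x y := by
  have hinv := mfderiv_extChartAt_comp_mfderivWithin_extChartAt_symm hy
  simp only [(𝓡 d).range_eq_univ, mfderivWithin_univ] at hinv
  rw [chartDensity_eq_normDet rfl]
  refine Eq.trans_le (by rw [finrank_euclideanSpace_fin])
    (inv_pow_le_normDet_of_antilipschitzWith hC ?_)
  refine AddMonoidHomClass.antilipschitz_of_bound _ fun u => ?_
  have hu := h (mfderiv (𝓡 d) (𝓡 d) (extChartAt (𝓡 d) x).symm y u)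
  rw [enorm_tangentSpace_vectorSpace] at hu
  have hu' : mfderiv (𝓡 d) (𝓡 d) (extChartAt (𝓡 d) x) ((extChartAt (𝓡 d) x).symm y)
      (mfderiv (𝓡 d) (𝓡 d) (extChartAt (𝓡 d) x).symm y u) = u := congr($hinv u)
  rw [hu'] at hu
  exact ENNReal.coe_le_coe.1 hu

section Local

variable [IsManifold (𝓡 d) 1 M]
  [IsContinuousRiemannianBundle (EuclideanSpace ℝ (Fin d)) (fun x : M => TangentSpace (𝓡 d) x)]

theorem eventually_enorm_mfderiv_extChartAt_apply_le (x : M) :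
    ∃ C > (0 : ℝ≥0), ∀ᶠ p in 𝓝 x, ∀ v : TangentSpace (𝓡 d) p,
      ‖mfderiv (𝓡 d) (𝓡 d) (extChartAt (𝓡 d) x) p v‖ₑ ≤ C * ‖v‖ₑ := by
  obtain ⟨C, hC, h⟩ := eventually_enorm_mfderiv_extChartAt_lt (𝓡 d) x
  refine ⟨C, hC, h.mono fun p hp v => ?_⟩
  let _ := fun y : EuclideanSpace ℝ (Fin d) => normedAddCommGroupTangentSpaceVectorSpace y
  let _ := fun y : EuclideanSpace ℝ (Fin d) => normedSpaceTangentSpaceVectorSpace y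
  rw [enorm_tangentSpace_vectorSpace]
  exact (ContinuousLinearMap.le_opENorm _ v).trans (mul_le_mul_left hp.le _)

theorem eventually_enorm_mfderiv_extChartAt_symm_apply_le (x : M) :
    ∃ C > (0 : ℝ≥0), ∀ᶠ y in 𝓝 (extChartAt (𝓡 d) x x), ∀ u : TangentSpace (𝓡 d) y,
      ‖mfderiv (𝓡 d) (𝓡 d) (extChartAt (𝓡 d) x).symm y u‖ₑ ≤ C * ‖u‖ₑ := by
  obtain ⟨C, hC, h⟩ := eventually_enorm_mfderivWithin_symm_extChartAt_lt (𝓡 d) x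
  simp only [(𝓡 d).range_eq_univ, nhdsWithin_univ, mfderivWithin_univ] at h
  refine ⟨C, hC, h.mono fun p hp v => ?_⟩
  let _ := fun y : EuclideanSpace ℝ (Fin d) => normedAddCommGroupTangentSpaceVectorSpace y
  let _ := fun y : EuclideanSpace ℝ (Fin d) => normedSpaceTangentSpaceVectorSpace y
  rw [enorm_tangentSpace_vectorSpace]
  exact (ContinuousLinearMap.le_opENorm _ v).trans (mul_le_mul_left hp.le _)

end Local

variable (d) in
/-- The preferred chart at `x` is `C`-bi-Lipschitz between the balls of radius `r` about `x` and its
image, and its volume density there lies between `C⁻ᵈ` and `Cᵈ`. Distances and volumes at scales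
below `r` near `x` can then be compared with the Euclidean ones. -/
structure ChartControl (x : M) (C : ℝ≥0) (r : ℝ) : Prop where
  ball_subset_source : Metric.ball x r ⊆ (extChartAt (𝓡 d) x).source
  ball_subset_target : Metric.ball (extChartAt (𝓡 d) x x) r ⊆ (extChartAt (𝓡 d) x).target
  lipschitz : LipschitzOnWith C (extChartAt (𝓡 d) x) (Metric.ball x r)
  lipschitz_symm :
    LipschitzOnWith C (extChartAt (𝓡 d) x).symm (Metric.ball (extChartAt (𝓡 d) x x) r)
  le_density : ∀ p ∈ Metric.ball x r, (C : ℝ)⁻¹ ^ d ≤ chartDensity x (extChartAt (𝓡 d) x p)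
  density_le : ∀ p ∈ Metric.ball x r, chartDensity x (extChartAt (𝓡 d) x p) ≤ (C : ℝ) ^ d

theorem exists_chartControl [IsManifold (𝓡 d) 1 M]
    [IsContinuousRiemannianBundle (EuclideanSpace ℝ (Fin d)) (fun x : M => TangentSpace (𝓡 d) x)]
    [IsRiemannianManifold (𝓡 d) M] (x : M) :
    ∃ C > (0 : ℝ≥0), ∃ r > 0, ChartControl d x C r := by
  set φ := extChartAt (𝓡 d) x
  obtain ⟨C₁, hC₁, h₁⟩ := eventually_enorm_mfderiv_extChartAt_apply_le (d := d) x
  obtain ⟨C₂, -, h₂⟩ := eventually_enorm_mfderiv_extChartAt_symm_apply_le (d := d) x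
  set C := max C₁ C₂
  have hC : 0 < C := hC₁.trans_le (le_max_left _ _)
  replace h₁ := h₁.mono fun p hp v => (hp v).trans <|
    mul_le_mul_left (ENNReal.coe_le_coe.2 (le_max_left C₁ C₂)) _
  replace h₂ := h₂.mono fun y hy u => (hy u).trans <|
    mul_le_mul_left (ENNReal.coe_le_coe.2 (le_max_right C₁ C₂)) _
  obtain ⟨r₁, hr₁, hball₁⟩ := Metric.mem_nhds_iff.1
    ((h₁.and ((continuousAt_extChartAt (I := 𝓡 d) x).eventually h₂)).and
      (extChartAt_source_mem_nhds (I := 𝓡 d) x))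
  obtain ⟨r₂, hr₂, hball₂⟩ := Metric.mem_nhds_iff.1
    (h₂.and (extChartAt_target_mem_nhds (I := 𝓡 d) x))
  have hlip := lipschitzOnWith_of_mfderiv_le (G := C)
    ((contMDiffOn_extChartAt (I := 𝓡 d) (n := 1) (x := x)).mono fun p hp =>
      extChartAt_source (I := 𝓡 d) x ▸ (hball₁ hp).2) fun p hp => (hball₁ hp).1.1
  have hlip_symm := lipschitzOnWith_of_mfderiv_le (G := C)
    ((contMDiffOn_extChartAt_symm (I := 𝓡 d) x).mono fun y hy => (hball₂ hy).2)
    fun y hy => (hball₂ hy).1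
  have hsub₁ : Metric.ball x (min r₁ r₂ / 3) ⊆ Metric.ball x (r₁ / 3) :=
    Metric.ball_subset_ball (by linarith [min_le_left r₁ r₂])
  have hsub₂ : Metric.ball (φ x) (min r₁ r₂ / 3) ⊆ Metric.ball (φ x) (r₂ / 3) :=
    Metric.ball_subset_ball (by linarith [min_le_right r₁ r₂])
  replace hball₁ := (hsub₁.trans (Metric.ball_subset_ball (by linarith))).trans hball₁
  replace hball₂ := (hsub₂.trans (Metric.ball_subset_ball (by linarith))).trans hball₂
  refine ⟨C, hC, min r₁ r₂ / 3, by positivity, fun p hp => (hball₁ hp).2,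
    fun y hy => (hball₂ hy).2, hlip.mono hsub₁, hlip_symm.mono hsub₂, fun p hp => ?_,
    fun p hp => chartDensity_le_pow (hball₁ hp).1.2⟩
  refine inv_pow_le_chartDensity (φ.map_source (hball₁ hp).2) hC ?_
  rw [φ.left_inv (hball₁ hp).2]
  exact (hball₁ hp).1.1

end ChartControl

section Volume

variable {d : ℕ} {M : Type*} [MetricSpace M] [ChartedSpace (EuclideanSpace ℝ (Fin d)) M]

theorem chartTransition_image {x x' : M} {s : Set M}
    (h : s ⊆ (extChartAt (𝓡 d) x).source) (h' : s ⊆ (extChartAt (𝓡 d) x').source) :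
    chartTransition x x' '' ((extChartAt (𝓡 d) x).target ∩ (extChartAt (𝓡 d) x).symm ⁻¹' s) =
      (extChartAt (𝓡 d) x').target ∩ (extChartAt (𝓡 d) x').symm ⁻¹' s := by
  rw [← PartialEquiv.image_eq_target_inter_inv_preimage _ h,
    ← PartialEquiv.image_eq_target_inter_inv_preimage _ h', chartTransition, image_comp,
    PartialEquiv.symm_image_image_of_subset_source _ h]

theorem injOn_chartTransition (x x' : M) :
    InjOn (chartTransition x x') (chartOverlap (d := d) x x') :=
  fun _ hy _ hw hyw => (extChartAt (𝓡 d) x).symm.injOn hy.1 hw.1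
    ((extChartAt (𝓡 d) x').injOn hy.2 hw.2 hyw)

variable [MeasurableSpace M] [BorelSpace M]

theorem measurableSet_target_inter_preimage (x : M) {s : Set M} (hs : MeasurableSet s) :
    MeasurableSet ((extChartAt (𝓡 d) x).target ∩ (extChartAt (𝓡 d) x).symm ⁻¹' s) := by
  have hcont := continuousOn_iff_continuous_domRestrict.1
    (continuousOn_extChartAt_symm (I := 𝓡 d) x)
  rw [← Subtype.image_preimage_coe]
  exact (isOpen_extChartAt_target x).measurableSet.subtype_image (hcont.measurable hs)

variable [RiemannianBundle (fun x : M => TangentSpace (𝓡 d) x)]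

theorem chartVolume_apply (x : M) {s : Set M} (hs : MeasurableSet s) :
    chartVolume (d := d) x s =
      ∫⁻ y in (extChartAt (𝓡 d) x).target ∩ (extChartAt (𝓡 d) x).symm ⁻¹' s,
        ENNReal.ofReal (chartDensity x y) := by
  have ht := (isOpen_extChartAt_target (I := 𝓡 d) x).measurableSet
  have hm : AEMeasurable (extChartAt (𝓡 d) x).symm
      (volume.restrict (extChartAt (𝓡 d) x).target) :=
    (continuousOn_extChartAt_symm x).aemeasurable ht
  rw [chartVolume, Measure.map_apply_of_aemeasurable
    (hm.mono_ac (withDensity_absolutelyContinuous _ _)) hs, ← restrict_withDensity ht,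
    Measure.restrict_apply' ht, inter_comm, withDensity_apply _
    (measurableSet_target_inter_preimage x hs)]

theorem chartVolume_inter_source (x : M) {s : Set M} (hs : MeasurableSet s) :
    chartVolume (d := d) x (s ∩ (extChartAt (𝓡 d) x).source) = chartVolume (d := d) x s := by
  rw [chartVolume_apply x hs,
    chartVolume_apply x (hs.inter (isOpen_extChartAt_source x).measurableSet), preimage_inter,
    inter_left_comm, inter_eq_left.2 (extChartAt (𝓡 d) x).target_subset_preimage_source, inter_comm]

theorem chartVolume_eq_chartVolume [IsManifold (𝓡 d) 1 M] (x x' : M) {s : Set M}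
    (hs : MeasurableSet s) (h : s ⊆ (extChartAt (𝓡 d) x).source)
    (h' : s ⊆ (extChartAt (𝓡 d) x').source) :
    chartVolume (d := d) x' s = chartVolume (d := d) x s := by
  have ht := measurableSet_target_inter_preimage (d := d) x hs
  have hsub : (extChartAt (𝓡 d) x).target ∩ (extChartAt (𝓡 d) x).symm ⁻¹' s ⊆ chartOverlap x x' :=
    inter_subset_inter_right _ (preimage_mono h')
  rw [chartVolume_apply x hs, chartVolume_apply x' hs,
    ← chartTransition_image h h',
    lintegral_image_eq_lintegral_abs_det_fderiv_mul volume ht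
      (fun y hy => (differentiableAt_chartTransition (hsub hy)).hasFDerivAt.hasFDerivWithinAt)
      ((injOn_chartTransition x x').mono hsub)]
  refine setLIntegral_congr_fun ht fun y hy => ?_
  rw [chartDensity_transition (hsub hy), ENNReal.ofReal_mul (abs_nonneg _)]

theorem riemannianVolume_eq_chartVolume [IsManifold (𝓡 d) 1 M] (x : M) {s : Set M}
    (hs : MeasurableSet s) (h : s ⊆ (extChartAt (𝓡 d) x).source) :
    riemannianVolume d M s = chartVolume (d := d) x s := by
  have hU (x : M) : MeasurableSet (extChartAt (𝓡 d) x).source :=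
    (isOpen_extChartAt_source x).measurableSet
  refine le_antisymm ?_ (Measure.le_iff'.1 (le_iSup (chartVolume (d := d)) x) s)
  suffices riemannianVolume d M ≤ chartVolume (d := d) x +
      (riemannianVolume d M).restrict (extChartAt (𝓡 d) x).sourceᶜ from
    (Measure.le_iff.1 this s hs).trans_eq <| by
      rw [Measure.add_apply, Measure.restrict_apply hs, ← sdiff_eq, sdiff_eq_empty.2 h,
        measure_empty, add_zero]
  refine iSup_le fun x' => Measure.le_iff.2 fun t ht => ?_
  rw [← measure_inter_add_sdiff t (hU x), Measure.add_apply, Measure.restrict_apply ht, ← sdiff_eq]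
  refine add_le_add ?_ (Measure.le_iff'.1 (le_iSup (chartVolume (d := d)) x') _)
  rw [← chartVolume_inter_source x' (ht.inter (hU x)), chartVolume_eq_chartVolume x x'
    ((ht.inter (hU x)).inter (hU x')) (fun y hy => hy.1.2) inter_subset_right]
  exact measure_mono fun y hy => hy.1.1

end Volume

section LocalVolume

variable {d : ℕ} {M : Type*} [MetricSpace M] [ChartedSpace (EuclideanSpace ℝ (Fin d)) M]
  [RiemannianBundle (fun x : M => TangentSpace (𝓡 d) x)] {x y : M} {C : ℝ≥0} {r t : ℝ}

theorem ChartControl.image_ball_subset (h : ChartControl d x C r) (hC : 0 < C)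
    (hyt : dist y x + t ≤ r) :
    extChartAt (𝓡 d) x '' Metric.ball y t ⊆ Metric.ball (extChartAt (𝓡 d) x y) (C * t) := by
  rintro _ ⟨p, hp, rfl⟩
  have hsub := Metric.ball_subset_ball' (add_comm t _ ▸ hyt)
  have hy : y ∈ Metric.ball y t := Metric.mem_ball_self (dist_nonneg.trans_lt hp)
  exact (h.lipschitz.dist_le_mul p (hsub hp) y (hsub hy)).trans_lt
    (mul_lt_mul_of_pos_left hp (NNReal.coe_pos.2 hC))

theorem ChartControl.ball_subset_image (h : ChartControl d x C r) (hC : 0 < C)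
    (hy : dist y x < r) (hyt : C * dist y x + t / C ≤ r) :
    Metric.ball (extChartAt (𝓡 d) x y) (t / C) ⊆ extChartAt (𝓡 d) x '' Metric.ball y t := by
  have hC' : (0 : ℝ) < C := NNReal.coe_pos.2 hC
  have hdist : dist (extChartAt (𝓡 d) x y) (extChartAt (𝓡 d) x x) ≤ C * dist y x :=
    h.lipschitz.dist_le_mul y hy x (Metric.mem_ball_self (dist_nonneg.trans_lt hy))
  intro w hw
  have ht : 0 < t / C := dist_nonneg.trans_lt hw
  have hwr : w ∈ Metric.ball (extChartAt (𝓡 d) x x) r :=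
    Metric.ball_subset_ball' (by linarith) hw
  have hyr : extChartAt (𝓡 d) x y ∈ Metric.ball (extChartAt (𝓡 d) x x) r :=
    Metric.mem_ball.2 (by linarith)
  refine ⟨(extChartAt (𝓡 d) x).symm w, ?_,
    (extChartAt (𝓡 d) x).right_inv (h.ball_subset_target hwr)⟩
  have hsymm := h.lipschitz_symm.dist_le_mul w hwr _ hyr
  rw [(extChartAt (𝓡 d) x).left_inv (h.ball_subset_source hy)] at hsymm
  exact hsymm.trans_lt ((lt_div_iff₀' hC').1 hw)

variable [MeasurableSpace M] [BorelSpace M] [IsManifold (𝓡 d) 1 M]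

theorem riemannianVolume_eq_lintegral_image {s : Set M} (hs : MeasurableSet s)
    (h : s ⊆ (extChartAt (𝓡 d) x).source) :
    riemannianVolume d M s =
      ∫⁻ w in extChartAt (𝓡 d) x '' s, ENNReal.ofReal (chartDensity x w) := by
  rw [riemannianVolume_eq_chartVolume x hs h, chartVolume_apply x hs,
    PartialEquiv.image_eq_target_inter_inv_preimage _ h]

theorem ChartControl.riemannianVolume_le (h : ChartControl d x C r) {s : Set M}
    (hs : MeasurableSet s) (hsr : s ⊆ Metric.ball x r) :
    riemannianVolume d M s ≤
      ENNReal.ofReal (C ^ d) * volume (extChartAt (𝓡 d) x '' s) := by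
  rw [riemannianVolume_eq_lintegral_image hs (hsr.trans h.ball_subset_source), ← setLIntegral_const]
  refine setLIntegral_mono measurable_const ?_
  rintro _ ⟨p, hp, rfl⟩
  exact ENNReal.ofReal_le_ofReal (h.density_le p (hsr hp))

theorem ChartControl.le_riemannianVolume (h : ChartControl d x C r) {s : Set M}
    (hs : MeasurableSet s) (hsr : s ⊆ Metric.ball x r) :
    ENNReal.ofReal ((C : ℝ)⁻¹ ^ d) * volume (extChartAt (𝓡 d) x '' s) ≤
      riemannianVolume d M s := by
  have hsource := hsr.trans h.ball_subset_source
  rw [riemannianVolume_eq_lintegral_image hs hsource, ← setLIntegral_const]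
  refine setLIntegral_mono' ?_ ?_
  · rw [PartialEquiv.image_eq_target_inter_inv_preimage _ hsource]
    exact measurableSet_target_inter_preimage x hs
  · rintro _ ⟨p, hp, rfl⟩
    exact ENNReal.ofReal_le_ofReal (h.le_density p (hsr hp))

theorem volume_ball_eq_ofReal_mul (w : EuclideanSpace ℝ (Fin d)) (ht : 0 < t) :
    volume (Metric.ball w t) =
      ENNReal.ofReal (t ^ d * volume.real (Metric.ball (0 : EuclideanSpace ℝ (Fin d)) 1)) := by
  rw [Measure.addHaar_ball_of_pos _ _ ht, finrank_euclideanSpace_fin,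
    ENNReal.ofReal_mul (by positivity), ofReal_measureReal measure_ball_lt_top.ne]

theorem ChartControl.le_riemannianVolume_ball (h : ChartControl d x C r) (hC : 0 < C) (ht : 0 < t)
    (hyt : dist y x + t ≤ r) (hyC : C * dist y x + t / C ≤ r) :
    ENNReal.ofReal ((C : ℝ)⁻¹ ^ d *
        ((t / C) ^ d * volume.real (Metric.ball (0 : EuclideanSpace ℝ (Fin d)) 1))) ≤
      riemannianVolume d M (Metric.ball y t) := by
  have : (0 : ℝ) < C := NNReal.coe_pos.2 hC
  rw [ENNReal.ofReal_mul (by positivity),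
    ← volume_ball_eq_ofReal_mul (extChartAt (𝓡 d) x y) (by positivity)]
  refine le_trans ?_ (h.le_riemannianVolume measurableSet_ball
    (Metric.ball_subset_ball' (add_comm t _ ▸ hyt)))
  gcongr
  exact h.ball_subset_image hC (by linarith) hyC

theorem ChartControl.riemannianVolume_ball_le (h : ChartControl d x C r) (hC : 0 < C) (ht : 0 < t)
    (hyt : dist y x + t ≤ r) :
    riemannianVolume d M (Metric.ball y t) ≤
      ENNReal.ofReal ((C : ℝ) ^ d *
        ((C * t) ^ d * volume.real (Metric.ball (0 : EuclideanSpace ℝ (Fin d)) 1))) := by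
  have : (0 : ℝ) < C := NNReal.coe_pos.2 hC
  rw [ENNReal.ofReal_mul (by positivity),
    ← volume_ball_eq_ofReal_mul (extChartAt (𝓡 d) x y) (by positivity)]
  refine (h.riemannianVolume_le measurableSet_ball
    (Metric.ball_subset_ball' (add_comm t _ ▸ hyt))).trans ?_
  gcongr
  exact h.image_ball_subset hC hyt

end LocalVolume

section Ahlfors

/-- `μ` is Ahlfors `d`-regular at the points of `s` up to scale `ρ`:
`c rᵈ ≤ μ(B(x, r)) ≤ C rᵈ` for `x ∈ s` and `0 < r ≤ ρ`. -/
structure AhlforsRegularOn {X : Type*} [PseudoMetricSpace X] [MeasurableSpace X] (d : ℕ)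
    (μ : Measure X) (s : Set X) (ρ c C : ℝ) : Prop where
  le_measure_ball : ∀ x ∈ s, ∀ r : ℝ, 0 < r → r ≤ ρ →
    ENNReal.ofReal (c * r ^ d) ≤ μ (Metric.ball x r)
  measure_ball_le : ∀ x ∈ s, ∀ r : ℝ, 0 < r → r ≤ ρ →
    μ (Metric.ball x r) ≤ ENNReal.ofReal (C * r ^ d)

theorem exists_ahlforsRegularOn_ball {d : ℕ} {M : Type*} [MetricSpace M]
    [ChartedSpace (EuclideanSpace ℝ (Fin d)) M] [IsManifold (𝓡 d) 1 M]
    [RiemannianBundle (fun x : M => TangentSpace (𝓡 d) x)]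
    [IsContinuousRiemannianBundle (EuclideanSpace ℝ (Fin d)) (fun x : M => TangentSpace (𝓡 d) x)]
    [IsRiemannianManifold (𝓡 d) M] [MeasurableSpace M] [BorelSpace M] (x : M) :
    ∃ ρ > 0, ∃ c > 0, ∃ C, AhlforsRegularOn d (riemannianVolume d M) (Metric.ball x ρ) ρ c C := by
  obtain ⟨C, hC, R, hR, h⟩ := exists_chartControl (d := d) x
  set v := volume.real (Metric.ball (0 : EuclideanSpace ℝ (Fin d)) 1)
  have hv : 0 < v :=
    ENNReal.toReal_pos (Metric.measure_ball_pos volume _ one_pos).ne' measure_ball_lt_top.ne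
  have : (0 : ℝ) < C := NNReal.coe_pos.2 hC
  set ρ := min (R / 2) (R / (C + (C : ℝ)⁻¹))
  have hρ : 0 < ρ := by positivity
  have hρR : ρ + ρ ≤ R := by linarith [min_le_left (R / 2) (R / (C + (C : ℝ)⁻¹))]
  have hρC : C * ρ + ρ / C ≤ R := by
    rw [div_eq_mul_inv, mul_comm ρ, ← add_mul, ← le_div_iff₀' (by positivity)]
    exact min_le_right _ _
  have hball : ∀ y ∈ Metric.ball x ρ, ∀ t ≤ ρ, dist y x + t ≤ R := fun y hy t ht => by
    linarith [Metric.mem_ball.1 hy]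
  refine ⟨ρ, hρ, (C : ℝ)⁻¹ ^ d * ((C : ℝ)⁻¹ ^ d * v), by positivity, C ^ d * (C ^ d * v),
    fun y hy t ht htρ => ?_, fun y hy t ht htρ => ?_⟩
  · have hyC : C * dist y x + t / C ≤ R :=
      (by gcongr; exact (Metric.mem_ball.1 hy).le : _ ≤ C * ρ + ρ / C).trans hρC
    convert h.le_riemannianVolume_ball hC ht (hball y hy t htρ) hyC using 2
    rw [div_pow, inv_pow]
    ring
  · convert h.riemannianVolume_ball_le hC ht (hball y hy t htρ) using 2
    rw [mul_pow]
    ring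

variable {X : Type*} [PseudoMetricSpace X] [MeasurableSpace X] {d : ℕ} {μ : Measure X}

theorem AhlforsRegularOn.mono {s t : Set X} {ρ ρ' c c' C C' : ℝ}
    (h : AhlforsRegularOn d μ s ρ c C) (hts : t ⊆ s) (hρ : ρ' ≤ ρ) (hc : c' ≤ c) (hC : C ≤ C') :
    AhlforsRegularOn d μ t ρ' c' C' where
  le_measure_ball x hx r hr hrρ := (ENNReal.ofReal_le_ofReal (by gcongr)).trans
    (h.le_measure_ball x (hts hx) r hr (hrρ.trans hρ))
  measure_ball_le x hx r hr hrρ := (h.measure_ball_le x (hts hx) r hr (hrρ.trans hρ)).trans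
    (ENNReal.ofReal_le_ofReal (by gcongr))

theorem AhlforsRegularOn.union {s t : Set X} {ρ c C : ℝ} (hs : AhlforsRegularOn d μ s ρ c C)
    (ht : AhlforsRegularOn d μ t ρ c C) : AhlforsRegularOn d μ (s ∪ t) ρ c C where
  le_measure_ball x hx := hx.elim (hs.le_measure_ball x) (ht.le_measure_ball x)
  measure_ball_le x hx := hx.elim (hs.measure_ball_le x) (ht.measure_ball_le x)

theorem exists_ahlforsRegularOn_of_isCompact {Ω : Set X} (hΩ : IsCompact Ω)
    (h : ∀ x ∈ Ω, ∃ ρ > 0, ∃ c > 0, ∃ C, AhlforsRegularOn d μ (Metric.ball x ρ) ρ c C) :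
    ∃ ρ > 0, ∃ c > 0, ∃ C, AhlforsRegularOn d μ Ω ρ c C := by
  refine hΩ.induction_on (p := fun s => ∃ ρ > 0, ∃ c > 0, ∃ C, AhlforsRegularOn d μ s ρ c C)
    ⟨1, one_pos, 1, one_pos, 1, by simp, by simp⟩ ?_ ?_ ?_
  · rintro s t hst ⟨ρ, hρ, c, hc, C, H⟩
    exact ⟨ρ, hρ, c, hc, C, H.mono hst le_rfl le_rfl le_rfl⟩
  · rintro s t ⟨ρ, hρ, c, hc, C, H⟩ ⟨ρ', hρ', c', hc', C', H'⟩
    exact ⟨min ρ ρ', lt_min hρ hρ', min c c', lt_min hc hc', max C C',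
      (H.mono Subset.rfl (min_le_left _ _) (min_le_left _ _) (le_max_left _ _)).union
        (H'.mono Subset.rfl (min_le_right _ _) (min_le_right _ _) (le_max_right _ _))⟩
  · intro x hx
    obtain ⟨ρ, hρ, H⟩ := h x hx
    exact ⟨_, mem_nhdsWithin_of_mem_nhds (Metric.ball_mem_nhds x hρ), ρ, hρ, H⟩

theorem AhlforsRegularOn.measure_lt_top {Ω : Set X} {ρ c C : ℝ}
    (h : AhlforsRegularOn d μ Ω ρ c C) (hρ : 0 < ρ) (hΩ : IsCompact Ω) : μ Ω < ⊤ :=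
  hΩ.measure_lt_top_of_nhdsWithin fun x hx =>
    ⟨_, mem_nhdsWithin_of_mem_nhds (Metric.ball_mem_nhds x hρ),
      (h.measure_ball_le x hx ρ hρ le_rfl).trans_lt ENNReal.ofReal_lt_top⟩

theorem AhlforsRegularOn.exists_measure_ball_inter_le {Ω : Set X} {ρ c C : ℝ}
    (h : AhlforsRegularOn d μ Ω ρ c C) (hρ : 0 < ρ) (hΩ : IsCompact Ω) :
    ∃ β, 0 ≤ β ∧ ∀ x ∈ Ω, ∀ r : ℝ, 0 < r →
      μ (Metric.ball x r ∩ Ω) ≤ ENNReal.ofReal (β * r ^ d) := by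
  refine ⟨max 0 (max C (μ.real Ω / ρ ^ d)), le_max_left _ _, fun x hx r hr => ?_⟩
  rcases le_total r ρ with hrρ | hrρ
  · refine (measure_mono inter_subset_left).trans ((h.measure_ball_le x hx r hr hrρ).trans ?_)
    gcongr
    exact (le_max_left _ _).trans (le_max_right _ _)
  · refine (measure_mono inter_subset_right).trans ?_
    rw [← ofReal_measureReal (h.measure_lt_top hρ hΩ).ne]
    refine ENNReal.ofReal_le_ofReal ?_
    calc
      μ.real Ω = μ.real Ω / ρ ^ d * ρ ^ d := by field_simp
      _ ≤ max 0 (max C (μ.real Ω / ρ ^ d)) * r ^ d := by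
        gcongr
        exact (le_max_right _ _).trans (le_max_right _ _)

theorem AhlforsRegularOn.exists_le_measure_ball_inter {Ω : Set X} {ρ c C R σ a : ℝ}
    (h : AhlforsRegularOn d μ Ω ρ c C) (hρ : 0 < ρ) (hc : 0 < c) (hR : 0 < R)
    (hcork : InteriorCorkscrew Ω R σ a) :
    ∃ α, 0 < α ∧ ∀ x ∈ Ω, ∀ r : ℝ, 0 < r → r ≤ R →
      ENNReal.ofReal (α * r ^ d) ≤ μ (Metric.ball x r ∩ Ω) := by
  have hσ := hcork.offset_pos
  have ha := hcork.ratio_pos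
  set m := min (a * (1 / 2 / (1 + σ))) (ρ / R)
  refine ⟨c * m ^ d, by positivity, fun x hx r hr hrR => ?_⟩
  obtain ⟨y, hy, -, -, hsub⟩ := hcork.exists_ball x hx (r / 2) (by positivity) (by linarith)
  have hmρ : m * r ≤ ρ := calc
    m * r ≤ ρ / R * R := by gcongr; exact min_le_right _ _
    _ = ρ := by field_simp
  have hma : m * r ≤ a * (r / 2 / (1 + σ)) := calc
    m * r ≤ a * (1 / 2 / (1 + σ)) * r := by gcongr; exact min_le_left _ _
    _ = a * (r / 2 / (1 + σ)) := by ring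
  calc
    ENNReal.ofReal (c * m ^ d * r ^ d) = ENNReal.ofReal (c * (m * r) ^ d) := by ring_nf
    _ ≤ μ (Metric.ball y (m * r)) := h.le_measure_ball y hy _ (by positivity) hmρ
    _ ≤ μ (Metric.ball x r ∩ Ω) := measure_mono fun p hp =>
      have hp' := hsub (Metric.ball_subset_ball hma hp)
      ⟨Metric.closedBall_subset_ball (by linarith) hp'.2, hp'.1⟩

end Ahlfors

section Norming

theorem supNorm_mono {M : Type*} (p : M → ℝ) {s t : Set M} (h : s ⊆ t) :
    supNorm p s ≤ supNorm p t :=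
  biSup_mono h

theorem supNorm_le_ofReal {M : Type*} {p : M → ℝ} {s : Set M} {m : ℝ}
    (h : ∀ y ∈ s, |p y| ≤ m) : supNorm p s ≤ ENNReal.ofReal m :=
  iSup₂_le fun y hy => by
    rw [← ofReal_norm]
    exact ENNReal.ofReal_le_ofReal (h y hy)

variable {d : ℕ} {M : Type*} [MetricSpace M] [ChartedSpace (EuclideanSpace ℝ (Fin d)) M]
  [RiemannianBundle (fun x : M => TangentSpace (𝓡 d) x)]

theorem enorm_mfderiv_apply_le_gradSupNorm (p : M → ℝ) {s : Set M} {y : M} (hy : y ∈ s)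
    (v : TangentSpace (𝓡 d) y) :
    ‖mfderiv (𝓡 d) 𝓘(ℝ, ℝ) p y v‖ₑ ≤ gradSupNorm d p s * ‖v‖ₑ := by
  have hle : ‖mfderiv (𝓡 d) 𝓘(ℝ, ℝ) p y‖ₑ ≤ gradSupNorm d p s :=
    le_iSup₂ (f := fun y (_ : y ∈ s) => ‖mfderiv (𝓡 d) 𝓘(ℝ, ℝ) p y‖ₑ) y hy
  exact ((mfderiv (𝓡 d) 𝓘(ℝ, ℝ) p y).le_opENorm v).trans (by gcongr)

variable {P : Submodule ℝ (M → ℝ)} {D K R : ℝ} {p : M → ℝ}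

theorem DoublingMarkov.mono {R' : ℝ} (h : DoublingMarkov d P D K R) (hR : R' ≤ R) :
    DoublingMarkov d P D K R' where
  __ := h
  doubling p hp r hr hrR := h.doubling p hp r hr (hrR.trans_le hR)
  markov p hp r hr hrR := h.markov p hp r hr (hrR.trans_le hR)

theorem DoublingMarkov.supNorm_ball_le_pow (h : DoublingMarkov d P D K R) (hp : p ∈ P) (y : M)
    {T : ℝ} (hT : 0 < T) (hTR : T / 2 < R) (k : ℕ) :
    supNorm p (Metric.ball y T) ≤
      ENNReal.ofReal (((2 : ℝ) ^ k) ^ D) * supNorm p (Metric.ball y (T / 2 ^ k)) := by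
  induction k with
  | zero => simp
  | succ k ih =>
    have hle : T / 2 ^ (k + 1) ≤ T / 2 := by
      gcongr
      exact le_self_pow₀ one_le_two k.succ_ne_zero
    calc
      _ ≤ ENNReal.ofReal (((2 : ℝ) ^ k) ^ D) * supNorm p (Metric.ball y (T / 2 ^ k)) := ih
      _ = ENNReal.ofReal (((2 : ℝ) ^ k) ^ D) *
          supNorm p (Metric.ball y (2 * (T / 2 ^ (k + 1)))) := by
        congr 3
        field_simp
        ring
      _ ≤ ENNReal.ofReal (((2 : ℝ) ^ k) ^ D) * (ENNReal.ofReal ((2 : ℝ) ^ D) *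
          supNorm p (Metric.ball y (T / 2 ^ (k + 1)))) := by
        gcongr
        exact h.doubling p hp _ (by positivity) (hle.trans_lt hTR) y
      _ = _ := by
        rw [← mul_assoc, ← ENNReal.ofReal_mul (by positivity), pow_succ,
          Real.mul_rpow (by positivity) (by positivity)]

theorem DoublingMarkov.supNorm_ball_le (h : DoublingMarkov d P D K R) (hp : p ∈ P) (y : M)
    {t T : ℝ} (ht : 0 < t) (htT : t ≤ T) (hTR : T / 2 < R) :
    supNorm p (Metric.ball y T) ≤
      ENNReal.ofReal ((2 * (T / t)) ^ D) * supNorm p (Metric.ball y t) := by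
  obtain ⟨n, hn, hn'⟩ := exists_nat_pow_near ((one_le_div ht).2 htT) (one_lt_two (α := ℝ))
  calc
    _ ≤ ENNReal.ofReal (((2 : ℝ) ^ (n + 1)) ^ D) * supNorm p (Metric.ball y (T / 2 ^ (n + 1))) :=
      h.supNorm_ball_le_pow hp y (ht.trans_le htT) hTR (n + 1)
    _ ≤ _ := by
      have hD := h.doubling_pos.le
      gcongr
      · rw [pow_succ']
        gcongr
      · refine supNorm_mono p (Metric.ball_subset_ball ?_)
        rw [div_le_comm₀ (by positivity) ht]
        exact hn'.le

theorem DoublingMarkov.abs_sub_le [IsRiemannianManifold (𝓡 d) M] (h : DoublingMarkov d P D K R)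
    (hp : p ∈ P) {x y z : M} {T m : ℝ} (hT : 0 < T) (hTR : T < R) (hm : 0 ≤ m)
    (hpm : supNorm p (Metric.ball z T) ≤ ENNReal.ofReal m) (hxy : dist x z + dist x y < T) :
    |p x - p y| ≤ K / T * m * dist x y := by
  have hK := h.markov_pos
  have hgrad : gradSupNorm d p (Metric.ball z T) ≤ ENNReal.ofReal (K / T * m) := by
    rw [ENNReal.ofReal_mul (by positivity)]
    exact (h.markov p hp T hT hTR z).trans (by gcongr)
  have hdist := dist_le_mul_of_mfderiv_le (I := 𝓡 d) (I' := 𝓘(ℝ, ℝ)) (G := (K / T * m).toNNReal)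
    (h.contMDiff p hp).contMDiffOn
    (fun u hu v => (enorm_mfderiv_apply_le_gradSupNorm p hu v).trans (mul_le_mul_left hgrad _)) hxy
  rwa [Real.coe_toNNReal _ (by positivity)] at hdist

variable {Ω : Set M} {σ a κ η : ℝ} {z : M} {m : ℝ}

theorem InteriorCorkscrew.supNorm_ball_le (h : InteriorCorkscrew Ω R σ a)
    (hP : DoublingMarkov d P D K R) (hz : z ∈ Ω) (hp : p ∈ P) {ρ T : ℝ} (hρ : 0 < ρ) (hρR : ρ < R)
    (hT : 0 ≤ T) (hTρ : T ≤ 2 * ρ) (hTR : T ≤ R)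
    (hm : ∀ x ∈ Ω, dist x z ≤ ρ → |p x| ≤ m) :
    supNorm p (Metric.ball z T) ≤ ENNReal.ofReal ((4 * ((2 + σ) / a)) ^ D * m) := by
  have hσ := h.offset_pos
  have := h.offset_le_one
  have ha := h.ratio_pos
  have ha' := h.ratio_le_one ⟨z, hz⟩ (hρ.trans hρR)
  have hD := hP.doubling_pos.le
  obtain ⟨y, -, hzy, -, hball⟩ := h.exists_ball z hz ρ hρ hρR
  set s := ρ / (1 + σ)
  have hs : 0 < s := by positivity
  have hsρ : (1 + σ) * s = ρ := mul_div_cancel₀ _ (by positivity)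
  have has : a * s ≤ s := mul_le_of_le_one_left hs.le ha'
  have hratio : 2 * ((s + T) / (a * s)) ≤ 4 * ((2 + σ) / a) := calc
    _ ≤ 2 * ((2 * (2 + σ) * s) / (a * s)) := by gcongr; nlinarith
    _ = 4 * ((2 + σ) / a) := by field_simp; ring
  calc
    supNorm p (Metric.ball z T) ≤ supNorm p (Metric.ball y (s + T)) :=
      supNorm_mono p (Metric.ball_subset_ball' (by rw [hzy, add_comm]))
    _ ≤ ENNReal.ofReal ((2 * ((s + T) / (a * s))) ^ D) * supNorm p (Metric.ball y (a * s)) :=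
      hP.supNorm_ball_le hp y (by positivity) (by linarith) (by nlinarith)
    _ ≤ ENNReal.ofReal ((4 * ((2 + σ) / a)) ^ D) * ENNReal.ofReal m := by
      gcongr
      exact supNorm_le_ofReal fun x hx => hm x (hball hx).1 (hball hx).2
    _ = _ := (ENNReal.ofReal_mul (by positivity)).symm

/- The point of `Ω ∩ closedBall z (3 κ η - 2 η)` where `|p|` is largest has a neighbour in `Ξ`
within `η`; by the Markov inequality `p` loses at most half of the maximum on the way there. -/
theorem DoublingMarkov.abs_apply_le_two_mul [IsRiemannianManifold (𝓡 d) M]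
    (hP : DoublingMarkov d P D K R) (h : InteriorCorkscrew Ω R σ a) (hΩ : IsCompact Ω)
    (hκ : 2 ≤ κ) (hκP : 2 * (K * (4 * ((2 + σ) / a)) ^ D) ≤ κ) (hη : 0 < η) (hηR : 3 * κ * η ≤ R)
    {Ξ : Set M} (hΞ : ∀ x ∈ Ω, ∃ ξ ∈ Ξ, dist x ξ ≤ η) (hz : z ∈ Ω) (hp : p ∈ P)
    (hm : ∀ ξ ∈ Ξ, dist ξ z ≤ 3 * κ * η → |p ξ| ≤ m) : |p z| ≤ 2 * m := by
  set A := (4 * ((2 + σ) / a)) ^ D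
  have hA : 0 ≤ A := by
    have := h.offset_pos
    have := h.ratio_pos
    positivity
  have hκη : 6 * η ≤ 3 * κ * η := by nlinarith
  set ρ := 3 * κ * η - 2 * η
  set T := 3 * κ * η - η / 2 with hT
  have hzρ : z ∈ Ω ∩ Metric.closedBall z ρ := ⟨hz, Metric.mem_closedBall_self (by linarith)⟩
  obtain ⟨x, ⟨hx, hxz⟩, hmax⟩ := (hΩ.inter_right Metric.isClosed_closedBall).exists_isMaxOn
    ⟨z, hzρ⟩ (hP.contMDiff p hp).continuous.abs.continuousOn
  obtain ⟨ξ, hξ, hxξ⟩ := hΞ x hx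
  rw [Metric.mem_closedBall] at hxz
  have hsup : supNorm p (Metric.ball z T) ≤ ENNReal.ofReal (A * |p x|) :=
    h.supNorm_ball_le hP hz hp (ρ := ρ) (by linarith) (by linarith) (by linarith) (by linarith)
      (by linarith) fun w hw hwz => hmax ⟨hw, hwz⟩
  have hdrop : |p x - p ξ| ≤ |p x| / 2 := calc
    |p x - p ξ| ≤ K / T * (A * |p x|) * dist x ξ :=
      hP.abs_sub_le hp (by linarith) (by linarith) (by positivity) hsup (by linarith)
    _ = K * A * dist x ξ / T * |p x| := by ring
    _ ≤ 1 / 2 * |p x| := by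
      refine mul_le_mul_of_nonneg_right ?_ (abs_nonneg _)
      rw [div_le_iff₀ (by linarith)]
      have : K * A * dist x ξ ≤ κ / 2 * η := by gcongr; linarith
      linarith
    _ = |p x| / 2 := by ring
  have hzx : |p z| ≤ |p x| := hmax hzρ
  have hξm : |p ξ| ≤ m := hm ξ hξ (by linarith [dist_triangle_left ξ z x])
  linarith [abs_sub_abs_le_abs_sub (p x) (p ξ)]

end Norming

section BackusGilbert

variable {M : Type*} {P : Submodule ℝ (M → ℝ)} {Ξ : Finset M} {W : M → M → ℝ} {z : M}
  {a b b' c : Ξ → ℝ}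

open Classical in
/-- The nodes that enter the Backus–Gilbert functional and its constraint at `z`: those of positive
weight. -/
noncomputable def activeNodes (Ξ : Finset M) (W : M → M → ℝ) (z : M) : Finset Ξ :=
  Finset.univ.filter fun ξ : Ξ => 0 < W ξ z

theorem mem_activeNodes {ξ : Ξ} : ξ ∈ activeNodes Ξ W z ↔ 0 < W ξ z := by
  simp [activeNodes]

theorem sum_activeNodes_eq (hW : ∀ ξ : Ξ, 0 ≤ W ξ z) {f : Ξ → ℝ}
    (hf : ∀ ξ : Ξ, W ξ z = 0 → f ξ = 0) :
    ∑ ξ ∈ activeNodes Ξ W z, f ξ = ∑ ξ, f ξ :=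
  Finset.sum_subset (Finset.subset_univ _) fun ξ _ hξ =>
    hf ξ ((hW ξ).antisymm' (not_lt.1 (mt mem_activeNodes.2 hξ)))

theorem bgCost_eq_sum_activeNodes :
    bgCost Ξ W z c = ∑ ξ ∈ activeNodes Ξ W z, 1 / W ξ z * |c ξ| ^ 2 := rfl

theorem bgFeasible_iff :
    BGFeasible P Ξ W z c ↔ ∀ p ∈ P, ∑ ξ ∈ activeNodes Ξ W z, c ξ * p ξ = p z := Iff.rfl

theorem continuous_bgCost : Continuous (bgCost Ξ W z) := by
  unfold bgCost
  fun_prop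

theorem isClosed_setOf_bgFeasible : IsClosed {c : Ξ → ℝ | BGFeasible P Ξ W z c} := by
  simp only [bgFeasible_iff, Set.ofPred_forall]
  exact isClosed_biInter fun p _ => isClosed_eq (by fun_prop) continuous_const

theorem bgCost_indicator_activeNodes :
    bgCost Ξ W z ((activeNodes Ξ W z : Set Ξ).indicator c) = bgCost Ξ W z c := by
  rw [bgCost_eq_sum_activeNodes, bgCost_eq_sum_activeNodes]
  exact Finset.sum_congr rfl fun ξ hξ => by rw [indicator_of_mem (Finset.mem_coe.2 hξ)]

theorem BGFeasible.indicator_activeNodes (hc : BGFeasible P Ξ W z c) :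
    BGFeasible P Ξ W z ((activeNodes Ξ W z : Set Ξ).indicator c) :=
  bgFeasible_iff.2 fun p hp => (Finset.sum_congr rfl fun ξ hξ => by
    rw [indicator_of_mem (Finset.mem_coe.2 hξ)]).trans (bgFeasible_iff.1 hc p hp)

theorem sq_abs_le_mul_bgCost (hW : ∀ ξ : Ξ, 0 ≤ W ξ z) (hc : ∀ ξ : Ξ, W ξ z = 0 → c ξ = 0)
    (ξ : Ξ) : |c ξ| ^ 2 ≤ W ξ z * bgCost Ξ W z c := by
  rcases (hW ξ).eq_or_lt with hξ | hξ
  · simp [hc ξ hξ.symm, ← hξ]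
  · rw [← div_le_iff₀' hξ, div_eq_mul_one_div, mul_comm, bgCost_eq_sum_activeNodes]
    exact Finset.single_le_sum (f := fun ξ : Ξ => 1 / W ξ z * |c ξ| ^ 2)
      (fun η _ => mul_nonneg (one_div_nonneg.2 (hW η)) (sq_nonneg _)) (mem_activeNodes.2 hξ)

theorem isCompact_setOf_bgCost_le (hW : ∀ ξ : Ξ, 0 ≤ W ξ z) (m : ℝ) :
    IsCompact {c : Ξ → ℝ | (∀ ξ : Ξ, W ξ z = 0 → c ξ = 0) ∧ bgCost Ξ W z c ≤ m} := by
  refine (isCompact_univ_pi fun ξ : Ξ => isCompact_Icc (a := -√(W ξ z * m))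
    (b := √(W ξ z * m))).of_isClosed_subset ?_ ?_
  · simp only [Set.ofPred_and, Set.ofPred_forall]
    exact (isClosed_iInter fun ξ => isClosed_iInter fun _ =>
      isClosed_eq (continuous_apply ξ) continuous_const).inter
        (isClosed_le continuous_bgCost continuous_const)
  · rintro c ⟨hc, hcm⟩ ξ -
    exact abs_le.1 (Real.le_sqrt_of_sq_le ((sq_abs_le_mul_bgCost hW hc ξ).trans
      (mul_le_mul_of_nonneg_left hcm (hW ξ))))

theorem exists_isShapeVector (hW : ∀ ξ : Ξ, 0 ≤ W ξ z) (ha : BGFeasible P Ξ W z a) :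
    ∃ b : Ξ → ℝ, IsShapeVector P Ξ W z b := by
  let trunc (c : Ξ → ℝ) : Ξ → ℝ := (activeNodes Ξ W z : Set Ξ).indicator c
  have htrunc (c : Ξ → ℝ) (ξ : Ξ) (hξ : W ξ z = 0) : trunc c ξ = 0 :=
    indicator_of_notMem (fun h => (mem_activeNodes.1 h).ne' hξ) c
  have hcost (c : Ξ → ℝ) : bgCost Ξ W z (trunc c) = bgCost Ξ W z c := bgCost_indicator_activeNodes
  obtain ⟨b, ⟨⟨hb₀, hba⟩, hb⟩, hmin⟩ :=
    ((isCompact_setOf_bgCost_le hW (bgCost Ξ W z a)).inter_right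
      (isClosed_setOf_bgFeasible (P := P))).exists_isMinOn
      ⟨trunc a, ⟨htrunc a, (hcost a).le⟩, ha.indicator_activeNodes⟩ continuous_bgCost.continuousOn
  refine ⟨b, hb₀, hb, fun c hc => ?_⟩
  rcases le_total (bgCost Ξ W z c) (bgCost Ξ W z a) with hca | hac
  · rw [← hcost c] at hca ⊢
    exact hmin ⟨⟨htrunc c, hca⟩, hc.indicator_activeNodes⟩
  · exact hba.trans hac

theorem BGFeasible.midpoint (hb : BGFeasible P Ξ W z b) (hb' : BGFeasible P Ξ W z b') :
    BGFeasible P Ξ W z fun ξ => (b ξ + b' ξ) / 2 := fun p hp => by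
  simp only [div_mul_eq_mul_div, add_mul, ← Finset.sum_div, Finset.sum_add_distrib, hb p hp,
    hb' p hp]
  ring

theorem bgCost_midpoint_add_bgCost_half_sub :
    bgCost Ξ W z (fun ξ => (b ξ + b' ξ) / 2) + bgCost Ξ W z (fun ξ => (b' ξ - b ξ) / 2) =
      (bgCost Ξ W z b + bgCost Ξ W z b') / 2 := by
  simp only [bgCost, sq_abs, ← Finset.sum_add_distrib, Finset.sum_div]
  exact Finset.sum_congr rfl fun ξ _ => by ring

theorem IsShapeVector.unique (hW : ∀ ξ : Ξ, 0 ≤ W ξ z) (hb : IsShapeVector P Ξ W z b)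
    (hb' : IsShapeVector P Ξ W z b') : b' = b := by
  have hmid := hb.feasible.midpoint hb'.feasible
  have hsub : bgCost Ξ W z (fun ξ => (b' ξ - b ξ) / 2) ≤ 0 := by
    linarith [hb.minimal _ hmid, hb'.minimal _ hmid,
      bgCost_midpoint_add_bgCost_half_sub (W := W) (z := z) (b := b) (b' := b')]
  ext ξ
  have hsq : |(b' ξ - b ξ) / 2| ^ 2 ≤ 0 :=
    (sq_abs_le_mul_bgCost (c := fun ξ => (b' ξ - b ξ) / 2) hW (fun ξ hξ => by
      simp only [hb.eq_zero ξ hξ, hb'.eq_zero ξ hξ, sub_self, zero_div]) ξ).trans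
      (mul_nonpos_of_nonneg_of_nonpos (hW ξ) hsub)
  linarith [abs_eq_zero.1 (pow_eq_zero_iff two_ne_zero |>.1 (hsq.antisymm (sq_nonneg _)))]

theorem IsShapeVector.eq_sum (hW : ∀ ξ : Ξ, 0 ≤ W ξ z) (hb : IsShapeVector P Ξ W z b) {p : M → ℝ}
    (hp : p ∈ P) : p z = ∑ ξ : Ξ, b ξ * p ξ := by
  rw [← bgFeasible_iff.1 hb.feasible p hp]
  exact sum_activeNodes_eq hW fun ξ hξ => by rw [hb.eq_zero ξ hξ, zero_mul]

theorem bgCost_le {c₁ C : ℝ} (hc₁ : 0 < c₁) (ha : ∀ ξ : Ξ, a ξ ≠ 0 → c₁ ≤ W ξ z)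
    (haC : ∑ ξ, |a ξ| ≤ C) : bgCost Ξ W z a ≤ C ^ 2 / c₁ :=
  calc
    bgCost Ξ W z a ≤ ∑ ξ ∈ activeNodes Ξ W z, 1 / c₁ * |a ξ| ^ 2 := Finset.sum_le_sum fun ξ _ => by
      rcases eq_or_ne (a ξ) 0 with hξ | hξ
      · simp [hξ]
      · have := ha ξ hξ
        gcongr
    _ ≤ ∑ ξ, 1 / c₁ * |a ξ| ^ 2 := Finset.sum_le_univ_sum_of_nonneg fun ξ => by positivity
    _ = 1 / c₁ * ∑ ξ, |a ξ| ^ 2 := by rw [Finset.mul_sum]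
    _ ≤ 1 / c₁ * (∑ ξ, |a ξ|) ^ 2 := by
      gcongr
      exact Finset.sum_sq_le_sq_sum_of_nonneg fun _ _ => abs_nonneg _
    _ ≤ 1 / c₁ * C ^ 2 := by gcongr
    _ = C ^ 2 / c₁ := by ring

theorem sq_sum_abs_le_bgCost_mul_card (hW : ∀ ξ : Ξ, 0 ≤ W ξ z) (hW₁ : ∀ ξ : Ξ, W ξ z ≤ 1)
    (hb : ∀ ξ : Ξ, W ξ z = 0 → b ξ = 0) :
    (∑ ξ, |b ξ|) ^ 2 ≤ bgCost Ξ W z b * (activeNodes Ξ W z).card := by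
  have hcost (ξ : Ξ) : 0 ≤ 1 / W ξ z * |b ξ| ^ 2 :=
    mul_nonneg (one_div_nonneg.2 (hW ξ)) (sq_nonneg _)
  rw [← sum_activeNodes_eq hW fun ξ hξ => abs_eq_zero.2 (hb ξ hξ)]
  calc
    (∑ ξ ∈ activeNodes Ξ W z, |b ξ|) ^ 2 ≤ bgCost Ξ W z b * ∑ ξ ∈ activeNodes Ξ W z, W ξ z :=
      Finset.sum_sq_le_sum_mul_sum_of_sq_le_mul _ (fun ξ _ => hcost ξ) (fun ξ _ => hW ξ)
        fun ξ hξ => by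
          have := (mem_activeNodes.1 hξ).ne'
          exact (by field_simp : |b ξ| ^ 2 = 1 / W ξ z * |b ξ| ^ 2 * W ξ z).le
    _ ≤ bgCost Ξ W z b * (activeNodes Ξ W z).card := by
      gcongr
      · exact Finset.sum_nonneg fun ξ _ => hcost ξ
      · simpa using Finset.sum_le_sum fun ξ (_ : ξ ∈ activeNodes Ξ W z) => hW₁ ξ

theorem exists_bgFeasible_bgCost_le {C c₁ : ℝ} (hC : 0 ≤ C) (hc₁ : 0 < c₁)
    (h : ∀ p ∈ P, ∀ m : ℝ, (∀ ξ : Ξ, c₁ ≤ W ξ z → |p ξ| ≤ m) → |p z| ≤ C * m) :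
    ∃ a : Ξ → ℝ, BGFeasible P Ξ W z a ∧ bgCost Ξ W z a ≤ C ^ 2 / c₁ := by
  classical
  let eval (x : M) : P →ₗ[ℝ] ℝ := LinearMap.proj x ∘ₗ P.subtype
  let χ (ξ : Ξ) : ℝ := if c₁ ≤ W ξ z then 1 else 0
  have hχ (ξ : Ξ) (hξ : χ ξ ≠ 0) : c₁ ≤ W ξ z := of_not_not fun hlt => hξ (if_neg hlt)
  obtain ⟨a, ha, haC⟩ := exists_eq_sum_smul_of_abs_le (fun ξ : Ξ => χ ξ • eval ξ) (eval z) hC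
    fun p m _ hm => h p p.2 m fun ξ hξ => by simpa [χ, hξ, eval] using hm ξ
  refine ⟨fun ξ => a ξ * χ ξ, bgFeasible_iff.2 fun p hp => ?_,
    bgCost_le hc₁ (fun ξ hξ => hχ ξ (right_ne_zero_of_mul hξ))
      (haC.trans' (Finset.sum_le_sum fun ξ _ => ?_))⟩
  · calc
      ∑ ξ ∈ activeNodes Ξ W z, a ξ * χ ξ * p ξ = ∑ ξ : Ξ, a ξ * χ ξ * p ξ :=
        Finset.sum_subset (Finset.subset_univ _) fun ξ _ hξ => by
          by_contra hne
          exact hξ (mem_activeNodes.2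
            (hc₁.trans_le (hχ ξ (right_ne_zero_of_mul (left_ne_zero_of_mul hne)))))
      _ = p z := by
        simpa [eval, mul_assoc] using (LinearMap.congr_fun ha ⟨p, hp⟩).symm
  · rw [abs_mul]
    exact mul_le_of_le_one_right (abs_nonneg _) (by unfold χ; split_ifs <;> simp)

end BackusGilbert

section Counting

theorem card_mul_le_of_separated {M ι : Type*} [PseudoMetricSpace M] [MeasurableSpace M]
    [OpensMeasurableSpace M] {μ : Measure M} {Ω : Set M} (hΩ : MeasurableSet Ω) {x : ι → M}
    {T : Finset ι} {z : M} {q δ A B : ℝ} (hB : 0 ≤ B)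
    (hsep : (T : Set ι).Pairwise fun i j => q ≤ dist (x i) (x j)) (hδ : ∀ i ∈ T, dist (x i) z ≤ δ)
    (hlow : ∀ i ∈ T, ENNReal.ofReal A ≤ μ (Metric.ball (x i) (q / 2) ∩ Ω))
    (hup : μ (Metric.ball z (δ + q / 2) ∩ Ω) ≤ ENNReal.ofReal B) : T.card * A ≤ B := by
  have hdisj : (T : Set ι).PairwiseDisjoint fun i => Metric.ball (x i) (q / 2) ∩ Ω :=
    fun i hi j hj hij => (Metric.ball_disjoint_ball
      ((add_halves q).le.trans (hsep hi hj hij))).mono inter_subset_left inter_subset_left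
  have hsub : ⋃ i ∈ T, Metric.ball (x i) (q / 2) ∩ Ω ⊆ Metric.ball z (δ + q / 2) ∩ Ω :=
    iUnion₂_subset fun i hi => inter_subset_inter_left _
      (Metric.ball_subset_ball' (by linarith [hδ i hi]))
  rw [← ENNReal.ofReal_le_ofReal_iff hB]
  calc
    ENNReal.ofReal (T.card * A) = ∑ _i ∈ T, ENNReal.ofReal A := by
      rw [Finset.sum_const, nsmul_eq_mul, ENNReal.ofReal_mul (Nat.cast_nonneg _),
        ENNReal.ofReal_natCast]
    _ ≤ ∑ i ∈ T, μ (Metric.ball (x i) (q / 2) ∩ Ω) := Finset.sum_le_sum hlow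
    _ = μ (⋃ i ∈ T, Metric.ball (x i) (q / 2) ∩ Ω) :=
      (measure_biUnion_finset hdisj fun i _ => measurableSet_ball.inter hΩ).symm
    _ ≤ ENNReal.ofReal B := (measure_mono hsub).trans hup

variable {M : Type*} [MetricSpace M] {Ω : Set M} {Ξ : Finset M} {R σ a : ℝ}

theorem exists_dist_le_fillDistance (hΩ : Bornology.IsBounded Ω) (hΞ : Ξ.Nonempty) {x : M}
    (hx : x ∈ Ω) : ∃ ξ ∈ Ξ, dist x ξ ≤ fillDistance Ξ Ω := by
  obtain ⟨ξ, hξ, h⟩ := Ξ.finite_toSet.isCompact.exists_infDist_eq_dist hΞ x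
  exact ⟨ξ, hξ, h ▸ le_csSup ((Metric.lipschitz_infDist_pt _).isBounded_image hΩ).bddAbove
    (mem_image_of_mem _ hx)⟩

theorem fillDistance_nonneg : 0 ≤ fillDistance Ξ Ω :=
  Real.sSup_nonneg (by rintro _ ⟨x, -, rfl⟩; exact Metric.infDist_nonneg)

theorem InteriorCorkscrew.exists_ne_dist_le (h : InteriorCorkscrew Ω R σ a)
    (hΩ : Bornology.IsBounded Ω) (hΞΩ : (Ξ : Set M) ⊆ Ω) {ξ : M} (hξ : ξ ∈ Ξ) {t : ℝ}
    (ht : fillDistance Ξ Ω < t) (htR : 2 * t < R) :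
    ∃ η ∈ Ξ, ξ ≠ η ∧ dist ξ η ≤ t + fillDistance Ξ Ω := by
  obtain ⟨x, hx, hxt⟩ := h.exists_dist_eq (hΞΩ hξ) (fillDistance_nonneg.trans_lt ht) htR
  obtain ⟨η, hη, hxη⟩ := exists_dist_le_fillDistance hΩ ⟨ξ, hξ⟩ hx
  refine ⟨η, hη, ?_, (dist_triangle ξ x η).trans (by gcongr; exact hxt.le)⟩
  rintro rfl
  rw [dist_comm, hxt] at hxη
  exact ht.not_ge hxη

theorem InteriorCorkscrew.separation_pos (h : InteriorCorkscrew Ω R σ a)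
    (hΩ : Bornology.IsBounded Ω) (hΞ : Ξ.Nonempty) (hΞΩ : (Ξ : Set M) ⊆ Ω)
    (hR : 2 * fillDistance Ξ Ω < R) : 0 < separation Ξ := by
  obtain ⟨ξ, hξ⟩ := hΞ
  obtain ⟨t, ht, htR⟩ := exists_between ((lt_div_iff₀' two_pos).2 hR)
  obtain ⟨η, hη, hne, -⟩ := h.exists_ne_dist_le hΩ hΞΩ hξ ht ((lt_div_iff₀' two_pos).1 htR)
  exact Ξ.finite_toSet.infsep_pos_iff_nontrivial.2 ⟨ξ, hξ, η, hη, hne⟩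

theorem InteriorCorkscrew.separation_le (h : InteriorCorkscrew Ω R σ a)
    (hΩ : Bornology.IsBounded Ω) (hΞ : Ξ.Nonempty) (hΞΩ : (Ξ : Set M) ⊆ Ω)
    (hR : 2 * fillDistance Ξ Ω < R) : separation Ξ ≤ 2 * fillDistance Ξ Ω := by
  obtain ⟨ξ, hξ⟩ := hΞ
  by_contra! hlt
  obtain ⟨t, ht, ht'⟩ := exists_between (lt_min ((lt_div_iff₀' two_pos).2 hR)
    (show fillDistance Ξ Ω < separation Ξ - fillDistance Ξ Ω by linarith))
  obtain ⟨htR, hts⟩ := lt_min_iff.1 ht'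
  obtain ⟨η, hη, hne, hd⟩ := h.exists_ne_dist_le hΩ hΞΩ hξ ht ((lt_div_iff₀' two_pos).1 htR)
  have : separation Ξ ≤ dist ξ η := Set.infsep_le_dist_of_mem hξ hη hne
  linarith

theorem card_activeNodes_le [MeasurableSpace M] [OpensMeasurableSpace M] {μ : Measure M} {d : ℕ}
    {W : M → M → ℝ} {z : M} {δ α β Y : ℝ} (hΩ : MeasurableSet Ω) (hΞΩ : (Ξ : Set M) ⊆ Ω)
    (hq : 0 < separation Ξ) (hW : ∀ ξ : Ξ, 0 < W ξ z → dist (ξ : M) z ≤ δ) (hα : 0 < α)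
    (hβ : 0 ≤ β) (hY : 0 ≤ Y)
    (hlow : ∀ x ∈ Ω, ENNReal.ofReal (α * (separation Ξ / 2) ^ d) ≤
      μ (Metric.ball x (separation Ξ / 2) ∩ Ω))
    (hup : μ (Metric.ball z (δ + separation Ξ / 2) ∩ Ω) ≤
      ENNReal.ofReal (β * (Y * (separation Ξ / 2)) ^ d)) :
    (activeNodes Ξ W z).card ≤ β / α * Y ^ d := by
  have hsep : ((activeNodes Ξ W z : Finset Ξ) : Set Ξ).Pairwise
      fun ξ η => separation Ξ ≤ dist (ξ : M) η := fun ξ _ η _ hne =>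
    Set.infsep_le_dist_of_mem ξ.2 η.2 (Subtype.coe_ne_coe.2 hne)
  have hcount := card_mul_le_of_separated hΩ (by positivity) hsep
    (fun ξ hξ => hW ξ (mem_activeNodes.1 hξ)) (fun ξ _ => hlow ξ (hΞΩ ξ.2)) hup
  rw [mul_pow, ← mul_assoc, ← mul_assoc] at hcount
  rw [div_mul_eq_mul_div, le_div_iff₀ hα]
  exact le_of_mul_le_mul_right hcount (by positivity)

end Counting

section Bounds

variable {M : Type*} {P : Submodule ℝ (M → ℝ)} {Ξ : Finset M} {W : M → M → ℝ} {z : M} {b : Ξ → ℝ}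

theorem sum_abs_le_mul_sqrt_mul_rpow {d : ℕ} {c₁ C α β Y : ℝ} (hW : ∀ ξ : Ξ, 0 ≤ W ξ z)
    (hW₁ : ∀ ξ : Ξ, W ξ z ≤ 1) (hb : ∀ ξ : Ξ, W ξ z = 0 → b ξ = 0) (hc₁ : 0 < c₁) (hC : 0 ≤ C)
    (hα : 0 < α) (hβ : 0 ≤ β) (hY : 0 ≤ Y) (hcost : bgCost Ξ W z b ≤ C ^ 2 / c₁)
    (hcard : (activeNodes Ξ W z).card ≤ β / α * Y ^ d) :
    ∑ ξ, |b ξ| ≤ C * √(β / (c₁ * α)) * Y ^ ((d : ℝ) / 2) := by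
  refine le_of_sq_le_sq ?_ (by positivity)
  have hYd : (Y ^ ((d : ℝ) / 2)) ^ 2 = Y ^ d := by
    rw [← Real.rpow_mul_natCast hY, Nat.cast_ofNat, div_mul_cancel₀ _ two_ne_zero,
      Real.rpow_natCast]
  calc
    (∑ ξ, |b ξ|) ^ 2 ≤ bgCost Ξ W z b * (activeNodes Ξ W z).card :=
      sq_sum_abs_le_bgCost_mul_card hW hW₁ hb
    _ ≤ C ^ 2 / c₁ * (β / α * Y ^ d) := by gcongr
    _ = (C * √(β / (c₁ * α)) * Y ^ ((d : ℝ) / 2)) ^ 2 := by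
      rw [mul_pow, mul_pow, hYd, Real.sq_sqrt (by positivity)]
      field_simp

end Bounds

section MovingLeastSquares

theorem add_half_eq {q : ℝ} (hq : q ≠ 0) (δ : ℝ) : δ + q / 2 = (1 + 2 * δ / q) * (q / 2) := by
  field_simp
  ring

theorem add_half_div_three_le {q δ : ℝ} (hq : 0 < q) (hqδ : q ≤ δ) :
    (δ + q / 2) / 3 ≤ δ / q * (q / 2) := by
  rw [div_mul_div_cancel₀ hq.ne']
  linarith

variable {d : ℕ} {M : Type*} [MetricSpace M] [ChartedSpace (EuclideanSpace ℝ (Fin d)) M]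
  [RiemannianBundle (fun x : M => TangentSpace (𝓡 d) x)]
  {Ω : Set M} {R σ a α β : ℝ}

theorem isContinuousRiemannianBundle_tangentSpace [IsManifold (𝓡 d) ∞ M]
    [IsContMDiffRiemannianBundle (𝓡 d) ∞ (EuclideanSpace ℝ (Fin d))
      (fun x : M => TangentSpace (𝓡 d) x)] :
    IsContinuousRiemannianBundle (EuclideanSpace ℝ (Fin d))
      (fun x : M => TangentSpace (𝓡 d) x) :=
  let ⟨g, hg, h⟩ := IsContMDiffRiemannianBundle.exists_contMDiff (IB := 𝓡 d) (n := ∞)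
    (F := EuclideanSpace ℝ (Fin d)) (E := fun x : M => TangentSpace (𝓡 d) x)
  ⟨g, hg.continuous, h⟩

theorem BallBound.upper_pos [MeasurableSpace M] (h : BallBound d Ω R α β) (hα : 0 < α)
    (hR : 0 < R) (hΩ : Ω.Nonempty) : 0 < β := by
  obtain ⟨z, hz⟩ := hΩ
  obtain ⟨hlow, hup⟩ := h z hz R hR le_rfl
  exact pos_of_mul_pos_left (ENNReal.ofReal_pos.1
    ((ENNReal.ofReal_pos.2 (by positivity : 0 < α * R ^ d)).trans_le (hlow.trans hup)))
    (by positivity)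

/-- The upper bound is stated at radius `r / 3` because the balls of radius `q / 2` around the
nodes in `B(z, δ)` lie in `B(z, δ + q / 2)`, and `δ + q / 2 ≤ 3 δ / 2`. -/
theorem InteriorCorkscrew.exists_ballBound [MeasurableSpace M] [BorelSpace M]
    [IsManifold (𝓡 d) 1 M] [IsContinuousRiemannianBundle (EuclideanSpace ℝ (Fin d))
      (fun x : M => TangentSpace (𝓡 d) x)]
    [IsRiemannianManifold (𝓡 d) M] (h : InteriorCorkscrew Ω R σ a) (hΩ : IsCompact Ω)
    (hR : 0 < R) :
    ∃ α w, 0 < α ∧ α ≤ w ∧ BallBound d Ω R α w ∧ ∀ x ∈ Ω, ∀ r : ℝ, 0 < r →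
      riemannianVolume d M (Metric.ball x r ∩ Ω) ≤ ENNReal.ofReal (w * (r / 3) ^ d) := by
  obtain ⟨ρ, hρ, c, hc, C, hreg⟩ := exists_ahlforsRegularOn_of_isCompact hΩ fun x _ =>
    exists_ahlforsRegularOn_ball (d := d) x
  obtain ⟨β, _, hup⟩ := hreg.exists_measure_ball_inter_le hρ hΩ
  obtain ⟨α, hα, hlow⟩ := hreg.exists_le_measure_ball_inter hρ hc hR h
  have hup' (x : M) (hx : x ∈ Ω) (r : ℝ) (hr : 0 < r) :
      riemannianVolume d M (Metric.ball x r ∩ Ω) ≤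
        ENNReal.ofReal (max α (3 ^ d * β) * (r / 3) ^ d) := by
    refine (hup x hx r hr).trans (ENNReal.ofReal_le_ofReal ?_)
    calc
      β * r ^ d = 3 ^ d * β * (r / 3) ^ d := by rw [div_pow]; field_simp
      _ ≤ max α (3 ^ d * β) * (r / 3) ^ d := by gcongr; exact le_max_right _ _
  have : 0 < max α (3 ^ d * β) := lt_max_of_lt_left hα
  refine ⟨α, max α (3 ^ d * β), hα, le_max_left _ _, fun x hx r hr hrR =>
    ⟨hlow x hx r hr hrR, (hup' x hx r hr).trans (ENNReal.ofReal_le_ofReal ?_)⟩, hup'⟩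
  gcongr
  linarith

theorem DoublingMarkov.exists_bgFeasible_bgCost_le [IsRiemannianManifold (𝓡 d) M]
    {P : Submodule ℝ (M → ℝ)} {D K κ : ℝ} (hP : DoublingMarkov d P D K R)
    (h : InteriorCorkscrew Ω R σ a) (hΩ : IsCompact Ω) (hκ : 2 ≤ κ)
    (hκP : 2 * (K * (4 * ((2 + σ) / a)) ^ D) ≤ κ) {Ξ : Finset M} (hΞ : Ξ.Nonempty)
    (hη : 0 < fillDistance Ξ Ω) (hηR : 3 * κ * fillDistance Ξ Ω ≤ R) {W : M → M → ℝ} {c₁ : ℝ}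
    (hc₁ : 0 < c₁) {z : M} (hz : z ∈ Ω)
    (hW : ∀ ξ : Ξ, dist (ξ : M) z ≤ 3 * κ * fillDistance Ξ Ω → c₁ ≤ W ξ z) :
    ∃ c : Ξ → ℝ, BGFeasible P Ξ W z c ∧ bgCost Ξ W z c ≤ 2 ^ 2 / c₁ :=
  MLS.exists_bgFeasible_bgCost_le zero_le_two hc₁ fun _ hp _ hm =>
    hP.abs_apply_le_two_mul h hΩ hκ hκP hη hηR
      (fun _ hx => exists_dist_le_fillDistance hΩ.isBounded hΞ hx) hz hp
      fun ξ hξ hdist => hm ⟨ξ, hξ⟩ (hW ⟨ξ, hξ⟩ hdist)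

theorem IsShapeVector.sum_abs_le [MeasurableSpace M] [OpensMeasurableSpace M]
    {P : Submodule ℝ (M → ℝ)} {Ξ : Finset M} {W : M → M → ℝ} {z : M} {b c : Ξ → ℝ}
    {c₁ C δ β' Y : ℝ} (hb : IsShapeVector P Ξ W z b) (hc : BGFeasible P Ξ W z c)
    (hcost : bgCost Ξ W z c ≤ C ^ 2 / c₁) (hW : ∀ ξ : Ξ, 0 ≤ W ξ z ∧ W ξ z ≤ 1)
    (hWδ : ∀ ξ : Ξ, W ξ z ≠ 0 → dist (ξ : M) z < δ) (hΩ : MeasurableSet Ω)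
    (hΞΩ : (Ξ : Set M) ⊆ Ω) (hq : 0 < separation Ξ) (hqR : separation Ξ / 2 ≤ R) (hc₁ : 0 < c₁)
    (hC : 0 ≤ C) (hα : 0 < α) (hβ : 0 ≤ β) (hY : 0 ≤ Y) (hball : BallBound d Ω R α β')
    (hup : riemannianVolume d M (Metric.ball z (δ + separation Ξ / 2) ∩ Ω) ≤
      ENNReal.ofReal (β * (Y * (separation Ξ / 2)) ^ d)) :
    ∑ ξ, |b ξ| ≤ C * √(β / (c₁ * α)) * Y ^ ((d : ℝ) / 2) :=
  sum_abs_le_mul_sqrt_mul_rpow (fun ξ => (hW ξ).1) (fun ξ => (hW ξ).2) hb.eq_zero hc₁ hC hα hβ hY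
    ((hb.minimal c hc).trans hcost)
    (card_activeNodes_le hΩ hΞΩ hq (fun ξ hξ => (hWδ ξ hξ.ne').le) hα hβ hY
      (fun x hx => (hball x hx _ (half_pos hq) hqR).1) hup)

end MovingLeastSquares

section Kappa

theorem two_le_one_add_div {x : ℝ} (hx : 0 < x) (hx₁ : x ≤ 1) : 2 ≤ (1 + x) / x := by
  rw [le_div_iff₀ hx]
  linarith

theorem two_mul_markov_mul_doubling_le_kappa {D K Γ₁ θ : ℝ} (hK : 0 ≤ K) (hσ : 0 < Real.sin θ)
    (ha : 0 < Γ₁ * Real.sin θ) (ha₁ : Γ₁ * Real.sin θ ≤ 1) :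
    2 * (K * (4 * ((2 + Real.sin θ) / (Γ₁ * Real.sin θ))) ^ D) ≤ kappa D K Γ₁ θ := by
  have h4 : (4 : ℝ) ^ D = 2 ^ (2 * D) := by
    rw [Real.rpow_mul zero_le_two]
    norm_num
  rw [kappa, Real.mul_rpow (by norm_num) (by positivity), h4, mul_comm 2, ← mul_assoc K]
  gcongr
  exact two_le_one_add_div ha ha₁

end Kappa

end MLS

theorem lemma5p1_general {d : ℕ} {M : Type*} [MetricSpace M] [MeasurableSpace M] [BorelSpace M]
    [ChartedSpace (EuclideanSpace ℝ (Fin d)) M] [IsManifold (𝓡 d) 1 M]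
    [RiemannianBundle (fun x : M => TangentSpace (𝓡 d) x)]
    [IsContinuousRiemannianBundle (EuclideanSpace ℝ (Fin d))
      (fun x : M => TangentSpace (𝓡 d) x)]
    [IsRiemannianManifold (𝓡 d) M] {Ω : Set M} (hΩ : IsCompact Ω) {R σ a : ℝ} (hR : 0 < R)
    (h : MLS.InteriorCorkscrew Ω R σ a) :
    ∃ αΩ wΩ : ℝ, 0 < αΩ ∧ αΩ ≤ wΩ ∧ MLS.BallBound d Ω R αΩ wΩ ∧
      ∀ (P : Submodule ℝ (M → ℝ)) (D K κ : ℝ), MLS.DoublingMarkov d P D K R →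
        2 ≤ κ → 2 * (K * (4 * ((2 + σ) / a)) ^ D) ≤ κ →
      ∀ Ξ : Finset M, Ξ.Nonempty → (Ξ : Set M) ⊆ Ω → MLS.fillDistance Ξ Ω ≤ R / (3 * κ) →
      ∀ (W : M → M → ℝ) (c₀ c₁ δ : ℝ), 0 < c₀ → c₀ ≤ 1 → 0 < c₁ →
        (∀ ζ ∈ Ω, ∀ z ∈ Ω, 0 ≤ W ζ z ∧ W ζ z ≤ 1) →
        (∀ ζ ∈ Ω, ∀ z ∈ Ω, δ ≤ dist ζ z → W ζ z = 0) →
        (∀ ζ ∈ Ω, ∀ z ∈ Ω, dist ζ z ≤ c₀ * δ → c₁ ≤ W ζ z) →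
        3 * κ / c₀ * MLS.fillDistance Ξ Ω ≤ δ →
      ∀ z ∈ Ω, ∃ b : Ξ → ℝ,
        MLS.IsShapeVector P Ξ W z b ∧ (∀ b', MLS.IsShapeVector P Ξ W z b' → b' = b) ∧
        (∀ p ∈ P, p z = ∑ ξ : Ξ, b ξ * p ξ) ∧
        (∀ ξ : Ξ, b ξ ≠ 0 → (ξ : M) ∈ Metric.ball z δ ∩ Ω) ∧
        ∑ ξ : Ξ, |b ξ| ≤
          2 * √(wΩ / (c₁ * αΩ)) * (δ / MLS.separation Ξ) ^ ((d : ℝ) / 2) ∧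
        (∀ α β : ℝ, 0 < α → MLS.BallBound d Ω R α β → δ + MLS.separation Ξ / 2 ≤ R →
          ∑ ξ : Ξ, |b ξ| ≤
            2 * √(β / (c₁ * α)) * (1 + 2 * δ / MLS.separation Ξ) ^ ((d : ℝ) / 2)) := by
  obtain ⟨αΩ, wΩ, hα, hαw, hball, hup⟩ := h.exists_ballBound (d := d) hΩ hR
  refine ⟨αΩ, wΩ, hα, hαw, hball, fun P D K κ hP hκ hκP Ξ hΞ hΞΩ hfill W c₀ c₁ δ hc₀ hc₀' hc₁
    hW hWδ hWc hδ z hz => ?_⟩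
  have hη₀ : 0 ≤ MLS.fillDistance Ξ Ω := MLS.fillDistance_nonneg
  have hηR : 3 * κ * MLS.fillDistance Ξ Ω ≤ R := (le_div_iff₀' (by positivity)).1 hfill
  have hηδ : 3 * κ * MLS.fillDistance Ξ Ω ≤ c₀ * δ := by
    rwa [div_mul_eq_mul_div, div_le_iff₀' hc₀] at hδ
  have hκη : 6 * MLS.fillDistance Ξ Ω ≤ 3 * κ * MLS.fillDistance Ξ Ω := by nlinarith
  have hq := h.separation_pos hΩ.isBounded hΞ hΞΩ (by linarith)
  have hqη := h.separation_le hΩ.isBounded hΞ hΞΩ (by linarith)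
  have hδ₀ : 0 < δ := pos_of_mul_pos_right (by linarith : 0 < c₀ * δ) hc₀.le
  have hqδ : MLS.separation Ξ ≤ δ := by nlinarith
  have hW' (ξ : Ξ) : 0 ≤ W ξ z ∧ W ξ z ≤ 1 := hW ξ (hΞΩ ξ.2) z hz
  have hWdist (ξ : Ξ) (hξ : W ξ z ≠ 0) : dist (ξ : M) z < δ :=
    not_le.1 (mt (hWδ ξ (hΞΩ ξ.2) z hz) hξ)
  obtain ⟨c, hc, hcost⟩ := hP.exists_bgFeasible_bgCost_le h hΩ hκ hκP hΞ (by linarith) hηR hc₁ hz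
    fun ξ hξ => hWc ξ (hΞΩ ξ.2) z hz (hξ.trans hηδ)
  obtain ⟨b, hb⟩ := MLS.exists_isShapeVector (fun ξ => (hW' ξ).1) hc
  have hw : 0 ≤ wΩ := hα.le.trans hαw
  have hsum {α β β' Y : ℝ} := hb.sum_abs_le (d := d) (R := R) (α := α) (β := β) (β' := β') (Y := Y)
    hc hcost hW' hWdist hΩ.measurableSet hΞΩ hq (by linarith) hc₁ zero_le_two
  refine ⟨b, hb, fun b' => hb.unique fun ξ => (hW' ξ).1, fun p => hb.eq_sum fun ξ => (hW' ξ).1,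
    fun ξ hξ => ⟨hWdist ξ (mt (hb.eq_zero ξ) hξ), hΞΩ ξ.2⟩,
    hsum hα hw (by positivity) hball ?_, fun α β hα hαβ hδR =>
    hsum hα (hαβ.upper_pos hα hR ⟨z, hz⟩).le (by positivity) hαβ ?_⟩
  · refine (hup z hz _ (by positivity)).trans (ENNReal.ofReal_le_ofReal ?_)
    gcongr
    exact MLS.add_half_div_three_le hq hqδ
  · rw [← MLS.add_half_eq hq.ne']
    exact (hαβ z hz _ (by positivity) hδR).2

theorem lemma5p1 {d : ℕ} {M : Type*} [MetricSpace M] [ConnectedSpace M]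
    [MeasurableSpace M] [BorelSpace M]
    [ChartedSpace (EuclideanSpace ℝ (Fin d)) M] [IsManifold (𝓡 d) ∞ M]
    [RiemannianBundle (fun x : M => TangentSpace (𝓡 d) x)]
    [IsContMDiffRiemannianBundle (𝓡 d) ∞ (EuclideanSpace ℝ (Fin d))
      (fun x : M => TangentSpace (𝓡 d) x)]
    [IsRiemannianManifold (𝓡 d) M]
    (Ω : Set M) (hΩ : IsCompact Ω)
    (rΩ Γ₁ Γ₂ : ℝ) (hrΩ : MLS.IsNormalRadius (d := d) Ω rΩ Γ₁ Γ₂)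
    (rflat θ : ℝ) (hrflat : 0 < rflat) (hθ₀ : 0 < θ) (hθ₁ : θ < Real.pi / 2)
    (hcone : MLS.InteriorCone d Ω rflat θ)
    (rsharp : ℝ) (hrsharp : 0 < rsharp)
    (rstar : ℝ) (hrstar : rstar = min rΩ (min rsharp rflat)) :
    ∃ αΩ wΩ : ℝ, 0 < αΩ ∧ αΩ ≤ wΩ ∧ MLS.BallBound d Ω rstar αΩ wΩ ∧
      ∀ (P : Submodule ℝ (M → ℝ)) (D K κ : ℝ), MLS.DoublingMarkov d P D K rsharp →
        κ = MLS.kappa D K Γ₁ θ →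
        (1 + Γ₁ * Real.sin θ) / (Γ₁ * Real.sin θ) ≤ κ →
      ∀ (Ξ : Finset M) (h q : ℝ), Ξ.Nonempty → (Ξ : Set M) ⊆ Ω →
        h = MLS.fillDistance Ξ Ω → q = MLS.separation Ξ → h ≤ rstar / (3 * κ) →
      ∀ (W : M → M → ℝ) (c₀ c₁ δ : ℝ), 0 < c₀ → c₀ < 1 → 0 < c₁ → c₁ ≤ 1 →
        (∀ ζ ∈ Ω, ∀ z ∈ Ω, 0 ≤ W ζ z ∧ W ζ z ≤ 1) →
        (∀ ζ ∈ Ω, ∀ z ∈ Ω, δ ≤ dist ζ z → W ζ z = 0) →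
        (∀ ζ ∈ Ω, ∀ z ∈ Ω, dist ζ z ≤ c₀ * δ → c₁ ≤ W ζ z) →
        3 * κ / c₀ * h ≤ δ →
      ∀ z ∈ Ω, ∃ b : Ξ → ℝ,
        MLS.IsShapeVector P Ξ W z b ∧ (∀ b', MLS.IsShapeVector P Ξ W z b' → b' = b) ∧
        (∀ p ∈ P, p z = ∑ ξ : Ξ, b ξ * p ξ) ∧
        (∀ ξ : Ξ, b ξ ≠ 0 → (ξ : M) ∈ Metric.ball z δ ∩ Ω) ∧
        ∑ ξ : Ξ, |b ξ| ≤ 2 * Real.sqrt (wΩ / (c₁ * αΩ)) * (δ / q) ^ ((d : ℝ) / 2) ∧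
        (∀ α β : ℝ, 0 < α → MLS.BallBound d Ω rstar α β → δ + q / 2 ≤ rstar →
          ∑ ξ : Ξ, |b ξ| ≤
            2 * Real.sqrt (β / (c₁ * α)) * (1 + 2 * δ / q) ^ ((d : ℝ) / 2)) := by
  have := MLS.isContinuousRiemannianBundle_tangentSpace (d := d) (M := M)
  have : IsManifold (𝓡 d) 1 M := .of_le (n := ∞) (by simp)
  have hσ : 0 < Real.sin θ := Real.sin_pos_of_pos_of_lt_pi hθ₀ (by linarith)
  have hR : 0 < rstar := hrstar ▸ lt_min hrΩ.radius_pos (lt_min hrsharp hrflat)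
  have hcork := hrΩ.interiorCorkscrew hcone hσ (R := rstar) (by simp [hrstar]) (by simp [hrstar])
  obtain ⟨αΩ, wΩ, hα, hαw, hball, H⟩ := lemma5p1_general (d := d) hΩ hR hcork
  refine ⟨αΩ, wΩ, hα, hαw, hball, ?_⟩
  rintro P D K _ hP rfl hκ Ξ _ _ hΞ hΞΩ rfl rfl hfill W c₀ c₁ δ hc₀ hc₀' hc₁ - hW hWδ hWc hδ z hz
  have ha₁ := hcork.ratio_le_one ⟨z, hz⟩ hR
  exact H P D K _ (hP.mono (by simp [hrstar]))
    ((MLS.two_le_one_add_div hcork.ratio_pos ha₁).trans hκ)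
    (MLS.two_mul_markov_mul_doubling_le_kappa hP.markov_pos.le hσ hcork.ratio_pos ha₁)
    Ξ hΞ hΞΩ hfill W c₀ c₁ δ hc₀ hc₀'.le hc₁ hW hWδ hWc hδ z hz
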